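/- A finite transition system over a finite set of propositions $\mathit{Prop}$ is a tuple $\mathcal S=(S,\to,\lambda)$ with a finite set $S$ of states, a left-total transition relation $\to\;\subseteq S\times S$ and a labeling $\lambda:\mathit{Prop}\to 2^S$. A path is a non-empty finite sequence $\pi=\pi(0)\pi(1)\cdots\pi(|\pi|)$ of states with $\pi(i)\to\pi(i+1)$ for $0\le i<|\pi|$, and for $0\le k\le l\le|\pi|$ we write $\pi[k,l]$ for the path $\pi(k)\cdots\pi(l)$. For $\iota,\gamma\in \mathit{Prop}$ let $[\![\langle\iota\triangleright\gamma\rangle]\!]$ be the set of all paths $\pi$ with $\pi(0)\in\lambda(\iota)$ and $\pi(|\pi|)\in\lambda(\gamma)$. For goals $g_i=\langle\iota_i\triangleright\gamma_i\rangle$, $1\le i\le n$, $n\ge 1$, let - $[\![\mathrm{OR}(g_1,\dots,g_n)]\!]=\bigcup_{i=1}^n[\![g_i]\!]$; - $[\![\mathrm{SAND}(g_1,\dots,g_n)]\!]=[\![g_1]\!].[\![g_2]\!].\,\cdots\,.[\![g_n]\!]$, where $A.B$ is the set of paths $\pi$ such that $\pi[0,i]\in A$ and $\pi[i,|\pi|]\in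 B$ for some $0\le i\le|\pi|$; - $[\![\mathrm{AND}(g_1,\dots,g_n)]\!]$ be the set of paths $\pi$ for which there are intervals $[k_i,l_i]\subseteq[0,|\pi|]$, $1\le i\le n$, with $\pi[k_i,l_i]\in[\![g_i]\!]$ for all $i$, such that every $[j,j+1]\subseteq[0,|\pi|]$ is contained in some $[k_i,l_i]$. For each operator $\mathrm{OP}\in\{\mathrm{OR},\mathrm{SAND},\mathrm{AND}\}$ consider the decision problem Over-Match: given $\mathcal S$ and $\iota,\gamma,\iota_1,\gamma_1,\dots,\iota_n,\gamma_n\in \mathit{Prop}$, decide whether $$[\![\mathrm{OP}(\langle\iota_1\triangleright\gamma_1\rangle,\dots,\langle\iota_n\triangleright\gamma_n\rangle)]\!]\supseteq[\![\langle\iota\triangleright\gamma\rangle]\!].$$ The input is written as a word over a fixed finite alphabet: the numbers of states and of propositions in unary, the adjacency matrix of $\to$, the labeling as one bit vector over $S$ for each proposition, and the goals by the unary indices of their propositions. Over-Match is in $\mathrm{PTIME}$ for $\mathrm{OP}=\mathrm{OR}$ and for $\mathrm{OP}=\mathrm{SAND}$, and it is in $\mathrm{coNP}$ for $\mathrm{OP}=\mathrm{AND}$.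 -/

import Mathlib

open Turing Computability

noncomputable section

/-! ### Complexity classes

Instances of a decision problem form a type `α`, written as words over a finite alphabet `Γ` by
`enc : α → List Γ`; the problem itself is the predicate `P : α → Prop` of its yes-instances.
The machines are Mathlib's multi-stack Turing machines `Turing.FinTM2`, time is their number of
steps, and the bounds are polynomials in the length of the input word. -/

open Classical in
/-- `P` is in `PTIME`: some Turing machine outputs the truth value of `P a` on the input `enc a`,
in polynomial time. -/
def InPTIME {α Γ : Type} (enc : α → List Γ) (P : α → Prop) : Prop :=
  Nonempty (TM2ComputableInPolyTime enc encodeBool (fun a => decide (P a)))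

/-- The word for an instance followed by a certificate, which is a word of bits. The two parts use
disjoint alphabets, so that the machine sees where the certificate starts. -/
def encodeWithCertificate {α Γ : Type} (enc : α → List Γ) (x : α × List Bool) :
    List (Γ ⊕ Bool) :=
  (enc x.1).map Sum.inl ++ x.2.map Sum.inr

/-- `P` is in `NP`: the yes-instances are those that have a certificate of polynomial length which
is accepted by a polynomial-time verifier `V`. -/
def InNP {α Γ : Type} (enc : α → List Γ) (P : α → Prop) : Prop :=
  ∃ (V : α × List Bool → Prop) (q : Polynomial ℕ),
    InPTIME (encodeWithCertificate enc) V ∧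
      ∀ a, P a ↔ ∃ w : List Bool, w.length ≤ q.eval (enc a).length ∧ V (a, w)

/-- `P` is in `coNP`: its complement is in `NP`. -/
def InCoNP {α Γ : Type} (enc : α → List Γ) (P : α → Prop) : Prop :=
  InNP enc (fun a => ¬ P a)

namespace AttackTree

/-! ### Transition systems and paths -/

/-- A transition system with set of states `S` over the set of propositions `AP`. -/
structure TransitionSystem (S AP : Type*) where
  /-- the transition relation, a subset of `S × S` -/
  trans : SetRel S S
  /-- the transition relation is left-total -/
  leftTotal : ∀ s, ∃ t, (s, t) ∈ trans
  /-- the labeling: the set of states labeled by a proposition -/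
  label : AP → Set S

variable {S AP : Type*}

/-- A path: a non-empty sequence of states in which consecutive states are related by a transition.
Its size, the number of transitions, is `π.length`, and its states are `π 0, …, π π.length`. -/
abbrev Path (M : TransitionSystem S AP) := RelSeries M.trans

/-- The factor of the path `π` on the interval `[k, l] ⊆ [0, π.length]`. -/
def Path.factor {M : TransitionSystem S AP} (π : Path M) (k l : ℕ) (hkl : k ≤ l)
    (hl : l ≤ π.length) : Path M where
  length := l - k
  toFun i := π.toFun ⟨k + i, by have := i.isLt; omega⟩
  step i := π.step ⟨k + i, by have := i.isLt; omega⟩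

/-- The interval `[k, l] ⊆ [0, π.length]` is an anchoring of the path `ρ` in the path `π`. -/
def IsAnchoring {M : TransitionSystem S AP} (ρ π : Path M) (k l : ℕ) : Prop :=
  ∃ (hkl : k ≤ l) (hl : l ≤ π.length), π.factor k l hkl hl = ρ

/-- Concatenation of two sets of paths. -/
def concat {M : TransitionSystem S AP} (A B : Set (Path M)) : Set (Path M) :=
  {π | ∃ (i : ℕ) (hi : i ≤ π.length),
    π.factor 0 i (Nat.zero_le i) hi ∈ A ∧ π.factor i π.length hi le_rfl ∈ B}

/-- Concatenation of a finite sequence of sets of paths (for the empty sequence, by convention, the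
paths of size `0`, the unit of concatenation). -/
def concatAll {M : TransitionSystem S AP} : List (Set (Path M)) → Set (Path M)
  | [] => {π | π.length = 0}
  | [A] => A
  | A :: B :: L => concat A (concatAll (B :: L))

/-- The sequence `ρ` of paths is a parallel decomposition of the path `π`. -/
def IsParallelDecomposition {M : TransitionSystem S AP} {n : ℕ} (ρ : Fin n → Path M)
    (π : Path M) : Prop :=
  ∃ k l : Fin n → ℕ, (∀ i, IsAnchoring (ρ i) π (k i) (l i)) ∧
    ∀ j, j + 1 ≤ π.length → ∃ i, k i ≤ j ∧ j + 1 ≤ l i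

/-! ### Goals and their path semantics -/

/-- The operators that compose goals. -/
inductive Op
  | OR
  | SAND
  | AND

/-- A goal `⟨ι ▷ γ⟩` is a pair `(ι, γ)` of propositions; its semantics is the set of the paths that
go from `ι` to `γ`. -/
def goalSem (M : TransitionSystem S AP) (g : AP × AP) : Set (Path M) :=
  {π | π.head ∈ M.label g.1 ∧ π.last ∈ M.label g.2}

/-- The path semantics of the composed goal `OP(g₁, …, gₙ)`. -/
def composedSem (M : TransitionSystem S AP) : Op → List (AP × AP) → Set (Path M)
  | .OR, gs => ⋃ g ∈ gs, goalSem M g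
  | .SAND, gs => concatAll (gs.map (goalSem M))
  | .AND, gs => {π | ∃ ρ : Fin gs.length → Path M,
      (∀ i, ρ i ∈ goalSem M (gs.get i)) ∧ IsParallelDecomposition ρ π}

/-! ### The decision problem -/

/-- An input of the decision problem: a finite transition system over a finite set of propositions,
a goal `⟨ι ▷ γ⟩`, and a non-empty sequence of goals `⟨ι₁ ▷ γ₁⟩, …, ⟨ιₙ ▷ γₙ⟩`. -/
structure Input where
  /-- number of states -/
  numStates : ℕ
  /-- number of propositions -/
  numProps : ℕ
  /-- the transition system -/
  system : TransitionSystem (Fin numStates) (Fin numProps)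
  /-- the main goal -/
  goal : Fin numProps × Fin numProps
  /-- the goals that are composed by the operator -/
  subgoals : List (Fin numProps × Fin numProps)
  /-- there is at least one of them -/
  subgoals_ne_nil : subgoals ≠ []

/-- Over-Match: `⟦OP(⟨ι₁ ▷ γ₁⟩, …, ⟨ιₙ ▷ γₙ⟩)⟧ ⊇ ⟦⟨ι ▷ γ⟩⟧`. -/
def OverMatch (op : Op) (x : Input) : Prop :=
  composedSem x.system op x.subgoals ⊇ goalSem x.system x.goal

/-- A natural number in unary. -/
def unary (k : ℕ) : List Bool := List.replicate k true

open Classical in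
/-- The bit vector of a set of states. -/
def bitVector {m : ℕ} (A : Set (Fin m)) : List Bool := List.ofFn fun s => decide (s ∈ A)

/-- A goal as two blocks, the unary indices of its two propositions. -/
def goalBlocks {p : ℕ} (g : Fin p × Fin p) : List (List Bool) := [unary g.1, unary g.2]

/-- An input as a list of blocks of bits: the number of states and the number of propositions in
unary, the rows of the adjacency matrix, the labeling as one bit vector for each proposition,
the main goal, and the other goals. -/
def inputBlocks (x : Input) : List (List Bool) :=
  [unary x.numStates, unary x.numProps]
    ++ List.ofFn (fun s => bitVector {t | (s, t) ∈ x.system.trans})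
    ++ List.ofFn (fun a => bitVector (x.system.label a))
    ++ goalBlocks x.goal
    ++ x.subgoals.flatMap goalBlocks

/-- The word over the alphabet `{0, 1, #}` that presents an input: every block is followed by the
end marker `# = none`. -/
def encodeInput (x : Input) : List (Option Bool) :=
  (inputBlocks x).flatMap fun b => b.map some ++ [none]

end AttackTree

end

/-! In all three cases one looks for a path of the main goal that does not match, and this search is
reduced to reachability in the graph with some set of states avoided. Such a set `Reach R B A` is a
fixed point reached after at most as many rounds as there are states (`iterate_eq_reach`).

For `OR` only the two ends of a path matter, so it suffices to test all pairs of states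
(`goalSem_subset_or_iff`).

For `SAND` a path matches if it starts in `ι₁`, ends in `γₙ`, and has cut positions in weakly
increasing order, the `i`-th in `γᵢ ∩ ιᵢ₊₁`. Cutting as early as possible is optimal. Hence one set
of states suffices as memory, namely those at which the first possible cut can lie, and it is
updated from one subgoal to the next (`uncut_cons`).

For `AND` the best interval for a goal goes from the first occurrence of its source to the last
occurrence of its target. So a path fails if some goal has no factor at all, or if some transition
is such that for every goal either no source occurs before it or no target occurs after it
(`not_covered_iff`). The certificate is the set of goals for which the first alternative holds. Once
it is fixed, a mismatch is a path whose prefix avoids the sources of these goals and whose remainder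
avoids the targets of the others, which is reachability again (`exists_not_covered_iff`).

The time bounds come from a small programming language. Data are binary trees, written in prefix
code on stacks, and structured programs on stacks compile to Turing machines (`Exec.reachesIn`). The
class `PolyTime` is closed under composition, pairing, case distinction and left folds whose
intermediate values have polynomial size; every procedure is assembled from these. -/

open Turing Computability

noncomputable section

/-! ### Structured programs on stacks -/

/-- Structured programs that work on a family of stacks. -/
inductive Prog {K : Type} (Γ : K → Type) : Type
  | push (k : K) (x : Γ k) : Prog Γ
  | pop (k : K) : Prog Γ
  | seq (p q : Prog Γ) : Prog Γ
  | ite (k : K) (f : Option (Γ k) → Bool) (p q : Prog Γ) : Prog Γ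
  | loop (k : K) (f : Option (Γ k) → Bool) (p : Prog Γ) : Prog Γ

namespace Prog

open Function

variable {K : Type} {Γ : K → Type}

section Exec

variable [DecidableEq K]

/-- `Exec p S S' n`: the program `p` leads from the stacks `S` to the stacks `S'` in `n` steps. -/
inductive Exec : Prog Γ → (∀ k, List (Γ k)) → (∀ k, List (Γ k)) → ℕ → Prop
  | push (k x S) : Exec (push k x) S (update S k (x :: S k)) 1
  | pop (k S) : Exec (pop k) S (update S k (S k).tail) 1
  | seq {p q S S' S'' m n} : Exec p S S' m → Exec q S' S'' n → Exec (seq p q) S S'' (n + m)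
  | iteTrue {k f p q S S' n} : f (S k).head? = true → Exec p S S' n →
      Exec (ite k f p q) S S' (n + 1)
  | iteFalse {k f p q S S' n} : f (S k).head? = false → Exec q S S' n →
      Exec (ite k f p q) S S' (n + 1)
  | loopTrue {k f p S S' S'' m n} : f (S k).head? = true → Exec p S S' m →
      Exec (loop k f p) S' S'' n → Exec (loop k f p) S S'' (n + (m + 1))
  | loopFalse {k f p S} : f (S k).head? = false → Exec (loop k f p) S S 1

/-- `Runs p S S' n`: the program `p` leads from `S` to `S'` in at most `n` steps. -/
def Runs (p : Prog Γ) (S S' : ∀ k, List (Γ k)) (n : ℕ) : Prop :=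
  ∃ m ≤ n, Exec p S S' m

end Exec

/-- The labels of the Turing machine for a program. -/
def Lab : Prog Γ → Type
  | push _ _ => Unit
  | pop _ => Unit
  | seq p q => p.Lab ⊕ q.Lab
  | ite _ _ p q => Option (p.Lab ⊕ q.Lab)
  | loop _ _ p => Option p.Lab

instance instFintypeLab : (p : Prog Γ) → Fintype p.Lab
  | push _ _ => inferInstanceAs (Fintype Unit)
  | pop _ => inferInstanceAs (Fintype Unit)
  | seq p q =>
    let _ := instFintypeLab p
    let _ := instFintypeLab q
    inferInstanceAs (Fintype (p.Lab ⊕ q.Lab))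
  | ite _ _ p q =>
    let _ := instFintypeLab p
    let _ := instFintypeLab q
    inferInstanceAs (Fintype (Option (p.Lab ⊕ q.Lab)))
  | loop _ _ p =>
    let _ := instFintypeLab p
    inferInstanceAs (Fintype (Option p.Lab))

/-- The label at which a program starts. -/
def entry : (p : Prog Γ) → p.Lab
  | push _ _ => ()
  | pop _ => ()
  | seq p _ => Sum.inl p.entry
  | ite _ _ _ _ => (none : Option _)
  | loop _ _ _ => (none : Option _)

/-- The statements of a program, inside a machine with labels `L`; the program continues at the
label `exit`. -/
def stmt {L : Type} : (p : Prog Γ) → (p.Lab → L) → L → p.Lab → TM2.Stmt Γ L Bool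
  | push k x, _, exit, _ => .push k (fun _ => x) (.goto fun _ => exit)
  | pop k, _, exit, _ => .pop k (fun v _ => v) (.goto fun _ => exit)
  | seq p q, emb, exit, l =>
    Sum.elim (p.stmt (fun l => emb (Sum.inl l)) (emb (Sum.inr q.entry)))
      (q.stmt (fun l => emb (Sum.inr l)) exit) l
  | ite k f p q, emb, exit, l =>
    Option.elim l
      (.peek k (fun _ x => f x) (.goto fun v =>
        cond v (emb (some (Sum.inl p.entry))) (emb (some (Sum.inr q.entry)))))
      (Sum.elim (p.stmt (fun l => emb (some (Sum.inl l))) exit)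
        (q.stmt (fun l => emb (some (Sum.inr l))) exit))
  | loop k f p, emb, exit, l =>
    Option.elim l
      (.peek k (fun _ x => f x) (.goto fun v => cond v (emb (some p.entry)) exit))
      (p.stmt (fun l => emb (some l)) (emb none))

variable [DecidableEq K]

/-- The machine `M` goes from `c` to `c'` in `n` steps. -/
def ReachesIn {L : Type} (M : L → TM2.Stmt Γ L Bool) (n : ℕ) (c c' : TM2.Cfg Γ L Bool) : Prop :=
  (flip bind (TM2.step M))^[n] (some c) = some c'

theorem ReachesIn.trans {L : Type} {M : L → TM2.Stmt Γ L Bool} {m n : ℕ}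
    {c c' c'' : TM2.Cfg Γ L Bool} (h : ReachesIn M m c c') (h' : ReachesIn M n c' c'') :
    ReachesIn M (n + m) c c'' := by
  unfold ReachesIn at *
  rw [Function.iterate_add_apply, h, h']

theorem ReachesIn.single {L : Type} {M : L → TM2.Stmt Γ L Bool} {l : L} {v : Bool}
    {S : ∀ k, List (Γ k)} {c : TM2.Cfg Γ L Bool} (h : TM2.stepAux (M l) v S = c) :
    ReachesIn M 1 ⟨some l, v, S⟩ c := by
  subst h; rfl

/-- Correctness of compilation, by induction on the execution. A part of a program sits at a smaller
block of labels, and its exit is the entry of what follows; the body of a loop exits at the test of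
the loop. The register holds only the outcome of a test, so its value at the start is irrelevant. -/
theorem Exec.reachesIn {L : Type} {M : L → TM2.Stmt Γ L Bool} {p : Prog Γ}
    {S S' : ∀ k, List (Γ k)} {n : ℕ} (h : Exec p S S' n) (emb : p.Lab → L) (exit : L)
    (hM : ∀ l, M (emb l) = p.stmt emb exit l) (v : Bool) :
    ∃ v', ReachesIn M n ⟨some (emb p.entry), v, S⟩ ⟨some exit, v', S'⟩ := by
  induction h generalizing exit v with
  | push k x S => exact ⟨v, .single (by rw [hM]; rfl)⟩
  | pop k S => exact ⟨v, .single (by rw [hM]; rfl)⟩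
  | @seq p q _ _ _ _ _ _ _ ih ih' =>
    obtain ⟨v', h'⟩ := ih (fun l => emb (Sum.inl l)) (emb (Sum.inr q.entry))
      (fun l => hM (Sum.inl l)) v
    obtain ⟨v'', h''⟩ := ih' (fun l => emb (Sum.inr l)) exit (fun l => hM (Sum.inr l)) v'
    exact ⟨v'', h'.trans h''⟩
  | @iteTrue k f p q _ _ _ hf _ ih =>
    obtain ⟨v', h'⟩ := ih (fun l => emb (some (Sum.inl l))) exit
      (fun l => hM (some (Sum.inl l))) true
    refine ⟨v', .trans (.single ?_) h'⟩
    rw [hM]; simp [stmt, entry, hf]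
  | @iteFalse k f p q _ _ _ hf _ ih =>
    obtain ⟨v', h'⟩ := ih (fun l => emb (some (Sum.inr l))) exit
      (fun l => hM (some (Sum.inr l))) false
    refine ⟨v', .trans (.single ?_) h'⟩
    rw [hM]; simp [stmt, entry, hf]
  | @loopTrue k f p _ _ _ _ _ hf _ _ ih ih' =>
    obtain ⟨v', h'⟩ := ih (fun l => emb (some l)) (emb none) (fun l => hM (some l)) true
    obtain ⟨v'', h''⟩ := ih' emb exit hM v'
    refine ⟨v'', .trans (.trans (.single ?_) h') h''⟩
    rw [hM]; simp [stmt, entry, hf]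
  | @loopFalse k f p _ hf =>
    refine ⟨false, .single ?_⟩
    rw [hM]; simp [stmt, entry, hf]

/-- The machine for a program; the label `none` is the one at which it halts. -/
def machine (p : Prog Γ) : Option p.Lab → TM2.Stmt Γ (Option p.Lab) Bool
  -- `haltList` prescribes the initial value of the register, which is therefore restored. This is
  -- the extra step in `Runs.outputs`.
  | none => .load (fun _ => false) .halt
  | some l => p.stmt some none l

/-- The bundled Turing machine for a program. -/
def toFinTM2 [Fintype K] (p : Prog Γ) (k₀ k₁ : K) [Fintype (Γ k₀)] : FinTM2 where
  k₀ := k₀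
  k₁ := k₁
  Γ := Γ
  Λ := Option p.Lab
  main := some p.entry
  σ := Bool
  initialState := false
  m := p.machine

theorem dite_eq_update (k₀ : K) (l : List (Γ k₀)) :
    (fun k => dite (k = k₀) (fun h => by rw [h]; exact l) fun _ => []) =
      update (fun _ => []) k₀ l := by
  funext k
  by_cases hk : k = k₀
  · subst hk; simp
  · rw [update_of_ne hk, dif_neg hk]

theorem Runs.outputs [Fintype K] {p : Prog Γ} {k₀ k₁ : K} [Fintype (Γ k₀)] {n : ℕ}
    {l : List (Γ k₀)} {l' : List (Γ k₁)}
    (h : Runs p (update (fun _ => []) k₀ l) (update (fun _ => []) k₁ l') n) :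
    Nonempty (TM2OutputsInTime (p.toFinTM2 k₀ k₁) l (some l') (n + 1)) := by
  obtain ⟨m, hm, h⟩ := h
  obtain ⟨v', h'⟩ := h.reachesIn (M := p.machine) some none (fun l => rfl) false
  have h'' : ReachesIn p.machine 1 ⟨some none, v', update (fun _ => []) k₁ l'⟩
      ⟨none, false, update (fun _ => []) k₁ l'⟩ := .single rfl
  have e : initList (p.toFinTM2 k₀ k₁) l =
      ⟨some (some p.entry), false, update (fun _ => []) k₀ l⟩ := by
    unfold initList
    congr 1
    exact dite_eq_update _ _
  have e' : haltList (p.toFinTM2 k₀ k₁) l' =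
      ⟨none, false, update (fun _ => []) k₁ l'⟩ := by
    unfold haltList
    congr 1
    exact dite_eq_update _ _
  refine ⟨⟨⟨1 + m, ?_⟩, show 1 + m ≤ n + 1 by omega⟩⟩
  exact (congrArg _ (congrArg some e)).trans
    (Eq.trans (h'.trans h'') (congrArg some e'.symm))

end Prog

/-! ### Binary trees on stacks -/

/-- Binary trees, the data of the programs. -/
inductive BinTree : Type
  | leaf : BinTree
  | node (l r : BinTree) : BinTree

namespace BinTree

/-- The prefix code of a tree. -/
def code : BinTree → List Bool
  | leaf => [false]
  | node l r => true :: (l.code ++ r.code)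

/-- The size of a tree, the length of its code. -/
def size (t : BinTree) : ℕ := t.code.length

/-- The code of a tree, as the contents of a stack. -/
def word (t : BinTree) : List (Option Bool) := t.code.map some

@[simp] theorem size_leaf : leaf.size = 1 := rfl

@[simp] theorem size_node (l r : BinTree) : (node l r).size = l.size + r.size + 1 := by
  simp [size, code]

@[simp] theorem word_leaf : leaf.word = [some false] := rfl

@[simp] theorem word_node (l r : BinTree) : (node l r).word = some true :: (l.word ++ r.word) := by
  simp [word, code]

theorem size_pos (t : BinTree) : 1 ≤ t.size := by
  cases t <;> simp

end BinTree

/-- The stacks of the programs: an input stack, an output stack, and four stacks for the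
computation. -/
inductive Stk : Type
  | inp | out | a | b | c | e
  deriving DecidableEq

instance : Fintype Stk :=
  ⟨{.inp, .out, .a, .b, .c, .e}, fun x => by cases x <;> simp⟩

/-- The alphabets of the stacks. -/
@[reducible] def Alph (Γ₀ : Type) : Stk → Type
  | .inp => Γ₀
  | .out => Bool
  | _ => Option Bool

/-- The stacks with the given contents. -/
def mem {Γ₀ : Type} (i : List Γ₀) (o : List Bool) (a b c e : List (Option Bool)) :
    ∀ k, List (Alph Γ₀ k)
  | .inp => i
  | .out => o
  | .a => a
  | .b => b
  | .c => c
  | .e => e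

namespace Prog

open Function

section Rules

variable {K : Type} {Γ : K → Type} [DecidableEq K] {p q : Prog Γ} {S S' S'' : ∀ k, List (Γ k)}
  {k : K} {f : Option (Γ k) → Bool} {m n : ℕ}

theorem Runs.mono (h : Runs p S S' m) (hmn : m ≤ n) : Runs p S S' n :=
  let ⟨t, ht, h⟩ := h
  ⟨t, ht.trans hmn, h⟩

theorem Runs.seq (h : Runs p S S' m) (h' : Runs q S' S'' n) : Runs (.seq p q) S S'' (m + n) :=
  let ⟨_, ht, h⟩ := h
  let ⟨_, ht', h'⟩ := h'
  ⟨_, by omega, .seq h h'⟩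

theorem Runs.push (k : K) (x : Γ k) (h : update S k (x :: S k) = S') : Runs (.push k x) S S' 1 :=
  h ▸ ⟨1, le_rfl, .push k x S⟩

theorem Runs.pop (k : K) (h : update S k (S k).tail = S') : Runs (.pop (Γ := Γ) k) S S' 1 :=
  h ▸ ⟨1, le_rfl, .pop k S⟩

theorem Runs.iteTrue (hf : f (S k).head? = true) (h : Runs p S S' n) :
    Runs (.ite k f p q) S S' (n + 1) :=
  let ⟨_, ht, h⟩ := h
  ⟨_, by omega, .iteTrue hf h⟩

theorem Runs.iteFalse (hf : f (S k).head? = false) (h : Runs q S S' n) :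
    Runs (.ite k f p q) S S' (n + 1) :=
  let ⟨_, ht, h⟩ := h
  ⟨_, by omega, .iteFalse hf h⟩

theorem Runs.loopTrue (hf : f (S k).head? = true) (h : Runs p S S' m)
    (h' : Runs (.loop k f p) S' S'' n) : Runs (.loop k f p) S S'' (m + n + 1) :=
  let ⟨_, ht, h⟩ := h
  let ⟨_, ht', h'⟩ := h'
  ⟨_, by omega, .loopTrue hf h h'⟩

theorem Runs.loopFalse (hf : f (S k).head? = false) : Runs (.loop k f p) S S 1 :=
  ⟨_, le_rfl, .loopFalse hf⟩

end Rules

variable {Γ₀ : Type} {i : List Γ₀} {o : List Bool} {a b c e x : List (Option Bool)}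

@[simp] theorem mem_inp : (mem i o a b c e : ∀ k, List (Alph Γ₀ k)) .inp = i := rfl
@[simp] theorem mem_out : (mem i o a b c e : ∀ k, List (Alph Γ₀ k)) .out = o := rfl
@[simp] theorem mem_a : (mem i o a b c e : ∀ k, List (Alph Γ₀ k)) .a = a := rfl
@[simp] theorem mem_b : (mem i o a b c e : ∀ k, List (Alph Γ₀ k)) .b = b := rfl
@[simp] theorem mem_c : (mem i o a b c e : ∀ k, List (Alph Γ₀ k)) .c = c := rfl
@[simp] theorem mem_e : (mem i o a b c e : ∀ k, List (Alph Γ₀ k)) .e = e := rfl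

@[simp] theorem update_mem_inp (x : List Γ₀) :
    update (mem i o a b c e : ∀ k, List (Alph Γ₀ k)) .inp x = mem x o a b c e := by
  funext k; cases k <;> rfl
@[simp] theorem update_mem_out (x : List Bool) :
    update (mem i o a b c e : ∀ k, List (Alph Γ₀ k)) .out x = mem i x a b c e := by
  funext k; cases k <;> rfl
@[simp] theorem update_mem_a :
    update (mem i o a b c e : ∀ k, List (Alph Γ₀ k)) .a x = mem i o x b c e := by
  funext k; cases k <;> rfl
@[simp] theorem update_mem_b :
    update (mem i o a b c e : ∀ k, List (Alph Γ₀ k)) .b x = mem i o a x c e := by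
  funext k; cases k <;> rfl
@[simp] theorem update_mem_c :
    update (mem i o a b c e : ∀ k, List (Alph Γ₀ k)) .c x = mem i o a b x e := by
  funext k; cases k <;> rfl
@[simp] theorem update_mem_e :
    update (mem i o a b c e : ∀ k, List (Alph Γ₀ k)) .e x = mem i o a b c x := by
  funext k; cases k <;> rfl

/-! ### Moving, erasing and duplicating trees on stacks -/

/-- The test for the symbol of a node. -/
def isNode (x : Option (Option Bool)) : Bool := x == some (some true)

/-- The test for a symbol of a tree, in contrast to a mark and to the end of the stack. -/
def isBit (x : Option (Option Bool)) : Bool := x.join.isSome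

/-- The loop of `lift`; stack `c` counts the trees that are to be moved. -/
def liftLoop : Prog (Alph Γ₀) :=
  .loop .c Option.isSome
    (.ite .a isNode
      (.seq (.pop .a) (.seq (.push .b (some true)) (.push .c none)))
      (.seq (.pop .a) (.seq (.push .b (some false)) (.pop .c))))

/-- Move the tree on stack `a` to stack `b`, on top of a mark. -/
def lift : Prog (Alph Γ₀) :=
  .seq (.push .b none) (.seq (.push .c none) liftLoop)

/-- A prefix code shows its own end if the pending trees are counted: a node symbol replaces one
pending tree by two, a leaf completes one. The rest of the run enters as the hypothesis `h`, so that
the induction can chain the two subtrees. Each symbol costs two tests and three stack operations. -/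
theorem runs_liftLoop (t : BinTree) {S : ∀ k, List (Alph Γ₀ k)} {n : ℕ}
    (h : Runs liftLoop (mem i o a (t.word.reverse ++ b) c e) S n) :
    Runs liftLoop (mem i o (t.word ++ a) b (none :: c) e) S (n + 5 * t.size) := by
  induction t generalizing a b c n with
  | leaf =>
    exact (Runs.loopTrue (m := 4) (S' := mem i o a (some false :: b) c e) (by simp)
      (.iteFalse (by simp [isNode]) (.seq (.pop _ rfl) (.seq (.push _ _ rfl) (.pop _ (by simp)))))
      (by simpa [liftLoop] using h)).mono (by simp; omega)
  | node l r ihl ihr =>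
    have h' := ihl (a := r.word ++ a) (b := some true :: b) (c := none :: c)
      (ihr (n := n) (by simpa using h))
    exact (Runs.loopTrue (m := 4) (by simp) (.iteTrue (by simp [isNode])
      (.seq (.pop _ rfl) (.seq (.push _ _ rfl) (.push _ _ (by simp))))) h').mono
      (by simp; omega)

theorem runs_lift (t : BinTree) :
    Runs lift (mem i o (t.word ++ a) b [] e) (mem i o a (t.word.reverse ++ none :: b) [] e)
      (5 * t.size + 3) :=
  (Runs.seq (.push _ _ (by simp; rfl)) (.seq (.push _ _ (by simp))
    (runs_liftLoop t (.loopFalse (by simp))))).mono (by omega)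

/-- The loop of `lower`. -/
def lowerLoop : Prog (Alph Γ₀) :=
  .loop .b isBit
    (.ite .b isNode
      (.seq (.pop .b) (.push .a (some true)))
      (.seq (.pop .b) (.push .a (some false))))

/-- Move the symbols above the topmost mark from stack `b` to stack `a`. -/
def lower : Prog (Alph Γ₀) :=
  .seq lowerLoop (.pop .b)

theorem runs_lowerLoop (w : List Bool) :
    Runs lowerLoop (mem i o a (w.map some ++ none :: b) c e)
      (mem i o (w.reverse.map some ++ a) (none :: b) c e) (4 * w.length + 1) := by
  induction w generalizing a with
  | nil => exact .loopFalse (by simp [isBit])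
  | cons x w ih =>
    refine (Runs.loopTrue (m := 3) (S' := mem i o (some x :: a) (w.map some ++ none :: b) c e)
      (by simp [isBit]) ?_ ?_).mono (n := 4 * (x :: w).length + 1) (m := 3 + (4 * w.length + 1) + 1)
      (by simp; omega)
    · cases x
      · exact .iteFalse (by simp [isNode]) (.seq (.pop _ rfl) (.push _ _ (by simp)))
      · exact .iteTrue (by simp [isNode]) (.seq (.pop _ rfl) (.push _ _ (by simp)))
    · simpa [lowerLoop] using ih (a := some x :: a)

theorem runs_lower (t : BinTree) :
    Runs lower (mem i o a (t.word.reverse ++ none :: b) c e) (mem i o (t.word ++ a) b c e)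
      (4 * t.size + 2) := by
  have h := runs_lowerLoop (i := i) (o := o) (a := a) (b := b) (c := c) (e := e) t.code.reverse
  simp only [List.map_reverse, List.reverse_reverse, List.length_reverse] at h
  exact (h.seq (.pop _ (by simp [BinTree.word]))).mono (by simp [BinTree.size])

/-- Remove the tree on stack `a`. -/
def drop : Prog (Alph Γ₀) :=
  .seq lift (.seq (.loop .b isBit (.pop .b)) (.pop .b))

theorem runs_drop (t : BinTree) :
    Runs drop (mem i o (t.word ++ a) b [] e) (mem i o a b [] e) (7 * t.size + 5) := by
  have h (w : List Bool) : Runs (.loop .b isBit (.pop .b)) (mem i o a (w.map some ++ none :: b) [] e)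
      (mem i o a (none :: b) [] e) (2 * w.length + 1) := by
    induction w with
    | nil => exact .loopFalse (by simp [isBit])
    | cons x w ih =>
      exact (Runs.loopTrue (by simp [isBit]) (.pop _ (by simp)) ih).mono (by simp; omega)
  have h' := h t.code.reverse
  rw [List.map_reverse, List.length_reverse] at h'
  exact ((runs_lift t).seq (.seq h' (.pop _ (by simp)))).mono (by simp [BinTree.size]; omega)

/-- The first loop of `dup`. -/
def dupLoop : Prog (Alph Γ₀) :=
  .loop .b isBit
    (.ite .b isNode
      (.seq (.pop .b) (.seq (.push .a (some true)) (.push .e (some true))))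
      (.seq (.pop .b) (.seq (.push .a (some false)) (.push .e (some false)))))

/-- The second loop of `dup`. -/
def dupLoop' : Prog (Alph Γ₀) :=
  .loop .e isBit
    (.ite .e isNode
      (.seq (.pop .e) (.push .b (some true)))
      (.seq (.pop .e) (.push .b (some false))))

/-- Duplicate the tree on stack `a`. -/
def dup : Prog (Alph Γ₀) :=
  .seq lift (.seq dupLoop (.seq dupLoop' lower))

/-- The lifted word goes back to `a` and at the same time to `e`; `dupLoop'` reverses the copy on
`e` onto the mark on `b`, from where `lower` delivers the second tree. -/
theorem runs_dupLoop (w : List Bool) :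
    Runs dupLoop (mem i o a (w.map some ++ none :: b) c e)
      (mem i o (w.reverse.map some ++ a) (none :: b) c (w.reverse.map some ++ e))
      (5 * w.length + 1) := by
  induction w generalizing a e with
  | nil => exact .loopFalse (by simp [isBit])
  | cons x w ih =>
    refine (Runs.loopTrue (m := 4)
      (S' := mem i o (some x :: a) (w.map some ++ none :: b) c (some x :: e))
      (by simp [isBit]) ?_ ?_).mono (n := 5 * (x :: w).length + 1) (m := 4 + (5 * w.length + 1) + 1)
      (by simp; omega)
    · cases x
      · exact .iteFalse (by simp [isNode])
          (.seq (.pop _ rfl) (.seq (.push _ _ rfl) (.push _ _ (by simp))))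
      · exact .iteTrue (by simp [isNode])
          (.seq (.pop _ rfl) (.seq (.push _ _ rfl) (.push _ _ (by simp))))
    · simpa [dupLoop] using ih (a := some x :: a) (e := some x :: e)

theorem runs_dupLoop' (w : List Bool) :
    Runs dupLoop' (mem i o a b c (w.map some))
      (mem i o a (w.reverse.map some ++ b) c []) (4 * w.length + 1) := by
  induction w generalizing b with
  | nil => exact .loopFalse (by simp [isBit])
  | cons x w ih =>
    refine (Runs.loopTrue (m := 3) (S' := mem i o a (some x :: b) c (w.map some))
      (by simp [isBit]) ?_ ?_).mono (n := 4 * (x :: w).length + 1) (m := 3 + (4 * w.length + 1) + 1)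
      (by simp; omega)
    · cases x
      · exact .iteFalse (by simp [isNode]) (.seq (.pop _ rfl) (.push _ _ (by simp)))
      · exact .iteTrue (by simp [isNode]) (.seq (.pop _ rfl) (.push _ _ (by simp)))
    · simpa [dupLoop'] using ih (b := some x :: b)

theorem runs_dup (t : BinTree) :
    Runs dup (mem i o (t.word ++ a) b [] []) (mem i o (t.word ++ (t.word ++ a)) b [] [])
      (18 * t.size + 7) := by
  have h₁ := runs_dupLoop (i := i) (o := o) (a := a) (b := b) (c := []) (e := []) t.code.reverse
  simp only [List.map_reverse, List.reverse_reverse, List.length_reverse, List.append_nil] at h₁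
  have h₂ := runs_dupLoop' (i := i) (o := o) (a := t.word ++ a) (b := none :: b) (c := []) t.code
  rw [List.map_reverse] at h₂
  exact ((runs_lift t).seq (h₁.seq (h₂.seq (runs_lower t)))).mono (by simp [BinTree.size]; omega)

end Prog

/-! ### Functions computable in polynomial time on coded data -/

/-- A coding of data by trees. -/
class Code (α : Type) where
  /-- the tree that codes an element -/
  tree : α → BinTree

namespace Code

instance : Code BinTree := ⟨id⟩

instance : Code Unit := ⟨fun _ => .leaf⟩

instance : Code Bool := ⟨fun x => cond x (.node .leaf .leaf) .leaf⟩

instance {α β : Type} [Code α] [Code β] : Code (α × β) := ⟨fun x => .node (tree x.1) (tree x.2)⟩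

instance {α : Type} [Code α] : Code (List α) := ⟨List.foldr (fun x t => .node (tree x) t) .leaf⟩

instance : Code ℕ := ⟨fun n => n.rec .leaf (fun _ t => .node .leaf t)⟩

/-- The size of the tree that codes an element. -/
def size {α : Type} [Code α] (x : α) : ℕ := (tree x).size

variable {α β : Type} [Code α] [Code β]

@[simp] theorem tree_true : tree true = .node .leaf .leaf := rfl
@[simp] theorem tree_false : tree false = .leaf := rfl
@[simp] theorem tree_unit (x : Unit) : tree x = .leaf := rfl
@[simp] theorem tree_nil : tree ([] : List α) = .leaf := rfl
@[simp] theorem tree_cons (x : α) (l : List α) : tree (x :: l) = .node (tree x) (tree l) := rfl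
@[simp] theorem tree_prod (x : α × β) : tree x = .node (tree x.1) (tree x.2) := rfl
@[simp] theorem tree_binTree (t : BinTree) : tree t = t := rfl
@[simp] theorem tree_succ (n : ℕ) : tree (n + 1) = .node .leaf (tree n) := rfl

theorem size_pos (x : α) : 1 ≤ size x := (tree x).size_pos

theorem size_bool_le (x : Bool) : size x ≤ 3 := by cases x <;> simp [size]
@[simp] theorem size_nil : size ([] : List α) = 1 := rfl
@[simp] theorem size_cons (x : α) (l : List α) : size (x :: l) = size x + size l + 1 := by
  simp [size]
@[simp] theorem size_prod (x : α × β) : size x = size x.1 + size x.2 + 1 := by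
  simp [size]

@[simp] theorem size_nat (n : ℕ) : size n = 2 * n + 1 := by
  induction n with
  | zero => rfl
  | succ n ih =>
    rw [size] at ih
    simp [size, ih]; omega

theorem size_append (l l' : List α) : size (l ++ l') + 1 = size l + size l' := by
  induction l with
  | nil => simp [add_comm]
  | cons x l ih => simp; omega

theorem size_reverse (l : List α) : size l.reverse = size l := by
  induction l with
  | nil => rfl
  | cons x l ih =>
    have := size_append l.reverse [x]
    simp at this ⊢; omega

theorem length_le_size (l : List α) : l.length ≤ size l := by
  induction l with
  | nil => simp
  | cons x l ih => simp; omega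

theorem size_le_of_mem {x : α} {l : List α} (h : x ∈ l) : size x ≤ size l := by
  induction l with
  | nil => simp at h
  | cons y l ih =>
    rcases List.mem_cons.1 h with rfl | h
    · simp; omega
    · have := ih h
      simp; omega

theorem size_le_of_prefix {l l' : List α} (h : l' <+: l) : size l' ≤ size l := by
  obtain ⟨s, rfl⟩ := h
  have := size_append l' s
  have := size_pos s
  omega

theorem size_le_of_suffix {l l' : List α} (h : l' <:+ l) : size l' ≤ size l := by
  obtain ⟨s, rfl⟩ := h
  have := size_append s l'
  have := size_pos s
  omega

theorem size_le_length_mul {l : List α} {B : ℕ} (h : ∀ x ∈ l, size x ≤ B) :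
    size l ≤ l.length * (B + 1) + 1 := by
  induction l with
  | nil => simp
  | cons x l ih =>
    have := ih fun y hy => h y (List.mem_cons_of_mem _ hy)
    have := h x (List.mem_cons_self)
    simp [add_mul]; omega

end Code

open Code Prog

theorem Polynomial.eval_nat_mono (p : Polynomial ℕ) : Monotone fun n => p.eval n := by
  intro m n h
  simp only [Polynomial.eval_eq_sum_range]
  gcongr

/-- The program `p` replaces the tree `t` on stack `a` by the tree `t'` in at most `n` steps. -/
def Replaces {Γ₀ : Type} (p : Prog (Alph Γ₀)) (t t' : BinTree) (n : ℕ) : Prop :=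
  ∀ i o a b, Runs p (mem i o (t.word ++ a) b [] []) (mem i o (t'.word ++ a) b [] []) n

/-- The function `f` on coded data is computable in polynomial time by programs. -/
def PolyTime {α β : Type} [Code α] [Code β] (f : α → β) : Prop :=
  ∃ T : Polynomial ℕ, (∀ x, size (f x) ≤ T.eval (size x)) ∧
    ∀ Γ₀ : Type, ∃ p : Prog (Alph Γ₀), ∀ x, Replaces p (tree x) (tree (f x)) (T.eval (size x))

namespace PolyTime

variable {α β γ δ : Type} [Code α] [Code β] [Code γ] [Code δ]

theorem of_le {f : α → β} (T T' : Polynomial ℕ) (hT : ∀ x, size (f x) ≤ T.eval (size x))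
    (h : ∀ Γ₀ : Type, ∃ p : Prog (Alph Γ₀), ∀ x, Replaces p (tree x) (tree (f x))
      (T'.eval (size x))) : PolyTime f := by
  refine ⟨T + T', fun x => (hT x).trans (by simp), fun Γ₀ => ?_⟩
  obtain ⟨p, hp⟩ := h Γ₀
  exact ⟨p, fun x i o a b => (hp x i o a b).mono (by simp)⟩

/-- Only codes are computed with, so a change of type that keeps the code is free. Thus a cons is a
pair, and a successor is a pair with the unit. -/
theorem of_tree_eq {f : α → β} (h : ∀ x, tree (f x) = tree x) : PolyTime f := by
  -- Pushing and popping a mark serves as the empty program.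
  refine of_le .X 2 (fun x => by simp [size, h]) fun Γ₀ => ⟨.seq (.push .c none) (.pop .c), ?_⟩
  intro x i o a b
  rw [h]
  exact (Runs.seq (.push _ _ rfl) (.pop _ (by simp))).mono (by simp)

theorem id : PolyTime (fun x : α => x) := of_tree_eq fun _ => rfl

theorem of_tree_eq_tree {f : α → β} {g : α → γ} (hg : PolyTime g)
    (h : ∀ x, tree (f x) = tree (g x)) : PolyTime f := by
  obtain ⟨T, hT, hp⟩ := hg
  refine ⟨T, fun x => by simpa only [size, h] using hT x, fun Γ₀ => ?_⟩
  obtain ⟨p, hp⟩ := hp Γ₀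
  exact ⟨p, fun x => by simpa only [h] using hp x⟩

theorem comp {g : β → γ} {f : α → β} (hg : PolyTime g) (hf : PolyTime f) :
    PolyTime fun x => g (f x) := by
  obtain ⟨T, hT, hp⟩ := hf
  obtain ⟨T', hT', hp'⟩ := hg
  have h (x) : T'.eval (size (f x)) ≤ (T'.comp T).eval (size x) := by
    rw [Polynomial.eval_comp]
    exact T'.eval_nat_mono (hT x)
  refine of_le (T'.comp T) (T + T'.comp T) (fun x => (hT' _).trans (h x)) fun Γ₀ => ?_
  obtain ⟨p, hp⟩ := hp Γ₀
  obtain ⟨p', hp'⟩ := hp' Γ₀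
  refine ⟨.seq p p', fun x i o a b => ((hp x i o a b).seq (hp' _ i o a b)).mono ?_⟩
  rw [Polynomial.eval_add]
  exact Nat.add_le_add_left (h x) _

/-- The argument is duplicated; `f` runs on the upper copy and its value waits on stack `b` while
`g` runs on the other. A node symbol on top of both values completes the code of the pair. -/
theorem pair {f : α → β} {g : α → γ} (hf : PolyTime f) (hg : PolyTime g) :
    PolyTime fun x => (f x, g x) := by
  obtain ⟨T, hT, hp⟩ := hf
  obtain ⟨T', hT', hp'⟩ := hg
  refine of_le (T + T' + 1) (18 * .X + 10 * T + T' + 13)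
    (fun x => by have := hT x; have := hT' x; simp; omega) fun Γ₀ => ?_
  obtain ⟨p, hp⟩ := hp Γ₀
  obtain ⟨p', hp'⟩ := hp' Γ₀
  refine ⟨.seq dup (.seq p (.seq lift (.seq p' (.seq lower (.push .a (some true)))))),
    fun x i o a b => ((runs_dup _).seq (.seq (hp _ _ _ _ _) (.seq (runs_lift _)
      (.seq (hp' _ _ _ _ _) (.seq (runs_lower _) (.push _ _ (by simp))))))).mono ?_⟩
  have := hT x
  simp only [size] at this
  simp [size]
  omega

theorem fst : PolyTime (fun x : α × β => x.1) := by
  refine of_le .X (20 * .X + 20) (fun x => by simp; omega) fun Γ₀ =>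
    ⟨.seq (.pop .a) (.seq lift (.seq drop lower)), fun x i o a b => ?_⟩
  refine (Runs.seq (.pop _ ?_) (.seq (runs_lift _) (.seq (runs_drop (tree x.2))
    (runs_lower _)))).mono ?_
  · simp
  · simp; simp [size]; omega

theorem snd : PolyTime (fun x : α × β => x.2) := by
  refine of_le .X (20 * .X + 20) (fun x => by simp; omega) fun Γ₀ =>
    ⟨.seq (.pop .a) drop, fun x i o a b => ?_⟩
  refine (Runs.seq (.pop _ ?_) (runs_drop (tree x.1))).mono ?_
  · simp
  · simp; simp [size]; omega

theorem leaf : PolyTime (fun _ : α => BinTree.leaf) := by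
  refine of_le 1 (20 * .X + 20) (fun x => by simp [size, tree]) fun Γ₀ =>
    ⟨.seq drop (.push .a (some false)), fun x i o a b => ?_⟩
  refine (Runs.seq (runs_drop (tree x)) (.push _ _ ?_)).mono ?_
  · simp [tree]
  · simp [size]; omega

theorem const (y : β) : PolyTime (fun _ : α => y) := by
  have h (t : BinTree) : PolyTime (fun _ : α => t) := by
    induction t with
    | leaf => exact leaf
    | node l r ihl ihr => exact of_tree_eq_tree (ihl.pair ihr) fun _ => rfl
  exact of_tree_eq_tree (h (tree y)) fun _ => rfl

theorem cond {c : α → Bool} {f g : α → β} (hc : PolyTime c) (hf : PolyTime f) (hg : PolyTime g) :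
    PolyTime fun x => bif c x then f x else g x := by
  obtain ⟨T, hT, hp⟩ := hc
  obtain ⟨T', hT', hp'⟩ := hf
  obtain ⟨T'', hT'', hp''⟩ := hg
  refine of_le (T' + T'') (18 * .X + T + T' + T'' + 20)
    (fun x => by have := hT' x; have := hT'' x; cases c x <;> simp <;> omega) fun Γ₀ => ?_
  obtain ⟨p, hp⟩ := hp Γ₀
  obtain ⟨p', hp'⟩ := hp' Γ₀
  obtain ⟨p'', hp''⟩ := hp'' Γ₀
  -- The code of `true` has three symbols and that of `false` has one; they are removed before the
  -- chosen branch runs on the remaining copy.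
  refine ⟨.seq dup (.seq p (.ite .a isNode
    (.seq (.pop .a) (.seq (.pop .a) (.seq (.pop .a) p'))) (.seq (.pop .a) p''))),
    fun x i o a b => ?_⟩
  cases hx : c x
  · refine ((runs_dup _).seq (.seq (hp x _ _ _ _) (.iteFalse (by simp [hx, isNode])
      (.seq (.pop _ (by simp [hx])) (hp'' x _ _ _ _))))).mono ?_
    simp [size]; omega
  · refine ((runs_dup _).seq (.seq (hp x _ _ _ _) (.iteTrue (by simp [hx, isNode])
      (.seq (.pop _ (by simp [hx]; rfl)) (.seq (.pop _ (by simp; rfl))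
        (.seq (.pop _ (by simp)) (hp' x _ _ _ _))))))).mono ?_
    simp [size]; omega

/-- The loop of the program for a left fold. -/
def foldlLoop {Γ₀ : Type} (p : Prog (Alph Γ₀)) : Prog (Alph Γ₀) :=
  .loop .a isNode (.seq (.pop .a) (.seq lower (.seq (.push .a (some true)) (.seq p lift))))

/-- Between rounds the accumulator is lifted to `b`, so that the list is exposed on `a`. Removing
its cons symbol uncovers the head; the accumulator is lowered onto it, and a node symbol makes the
two a pair for `p`. -/
theorem runs_foldlLoop {Γ₀ : Type} {p : Prog (Alph Γ₀)} {f : β × α → β} {T : Polynomial ℕ}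
    (hp : ∀ x, Replaces p (tree x) (tree (f x)) (T.eval (size x))) (Q N : ℕ) (l : List α) (y : β)
    (hl : ∀ x ∈ l, size x ≤ N)
    (hQ : ∀ l', l' <+: l → size (l'.foldl (fun y x => f (y, x)) y) ≤ Q)
    (i : List Γ₀) (o : List Bool) (a b : List (Option Bool)) :
    Runs (foldlLoop p)
      (mem i o ((tree l).word ++ a) ((tree y).word.reverse ++ none :: b) [] [])
      (mem i o (some false :: a)
        ((tree (l.foldl (fun y x => f (y, x)) y)).word.reverse ++ none :: b) [] [])
      (l.length * (9 * Q + T.eval (Q + N + 1) + 10) + 1) := by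
  induction l generalizing y with
  | nil => exact (Runs.loopFalse (by simp [isNode])).mono (by simp)
  | cons x l ih =>
    have ih := ih (f (y, x)) (fun x hx => hl x (List.mem_cons_of_mem _ hx))
      fun l' hl' => hQ (x :: l') (List.cons_prefix_cons.2 ⟨rfl, hl'⟩)
    have h₀ : size y ≤ Q := hQ [] List.nil_prefix
    have h₁ : size (f (y, x)) ≤ Q := hQ [x] (by simp)
    have hx : size x ≤ N := hl x (by simp)
    have hT : T.eval (size (y, x)) ≤ T.eval (Q + N + 1) := T.eval_nat_mono (by simp; omega)
    have hp' : Runs p (mem i o (some true :: ((tree y).word ++ ((tree x).word ++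
        ((tree l).word ++ a)))) b [] [])
        (mem i o ((tree (f (y, x))).word ++ ((tree l).word ++ a)) b [] [])
        (T.eval (size (y, x))) := by
      simpa using hp (y, x) i o ((tree l).word ++ a) b
    have body : Runs (.seq (.pop .a) (.seq lower (.seq (.push .a (some true)) (.seq p lift))))
        (mem i o ((tree (x :: l)).word ++ a) ((tree y).word.reverse ++ none :: b) [] [])
        (mem i o ((tree l).word ++ a) ((tree (f (y, x))).word.reverse ++ none :: b) [] [])
        (1 + (4 * size y + 2 + (1 + (T.eval (size (y, x)) + (5 * size (f (y, x)) + 3))))) :=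
      .seq (.pop _ (by simp; rfl)) (.seq (runs_lower (tree y)) (.seq (.push _ _ (by simp))
        (.seq hp' (runs_lift _))))
    unfold foldlLoop at ih ⊢
    refine (Runs.loopTrue (k := .a) (f := isNode) (by simp [isNode]) body ih).mono ?_
    simp only [size, List.length_cons] at *
    rw [add_mul]
    omega

/-- The bound `hq` on the values after each prefix is essential: a step that doubles its argument
would otherwise lead to exponential size. -/
theorem foldl_of_pair {f : β × α → β} {h : γ → β × List α} (hf : PolyTime f) (hh : PolyTime h)
    (q : Polynomial ℕ) (hq : ∀ c l, l <+: (h c).2 →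
      size (l.foldl (fun y x => f (y, x)) (h c).1) ≤ q.eval (size c)) :
    PolyTime fun c => (h c).2.foldl (fun y x => f (y, x)) (h c).1 := by
  obtain ⟨T, hT, hp⟩ := hf
  obtain ⟨T', hT', hp'⟩ := hh
  refine of_le q (T' + T' * (9 * q + T.comp (q + T' + 1) + 10) + 9 * q + 9)
    (fun c => hq c _ List.prefix_rfl) fun Γ₀ => ?_
  obtain ⟨p, hp⟩ := hp Γ₀
  obtain ⟨p', hp'⟩ := hp' Γ₀
  refine ⟨.seq p' (.seq (.pop .a) (.seq lift (.seq (foldlLoop p) (.seq (.pop .a) lower)))),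
    fun c i o a b => ?_⟩
  have hN : size (h c).2 ≤ T'.eval (size c) := by
    have := hT' c
    simp at this; omega
  have h₀ : size (h c).1 ≤ q.eval (size c) := hq c [] List.nil_prefix
  have h₁ := hq c _ List.prefix_rfl
  refine ((hp' c _ _ _ _).seq (.seq (.pop _ (by simp; rfl)) (.seq (runs_lift _)
    (.seq (runs_foldlLoop hp (q.eval (size c)) (T'.eval (size c)) _ _
      (fun x hx => (size_le_of_mem hx).trans hN) (hq c) _ _ _ _)
      (.seq (.pop _ (by simp)) (runs_lower _)))))).mono ?_
  have := Nat.mul_le_mul_right (9 * q.eval (size c) +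
    T.eval (q.eval (size c) + T'.eval (size c) + 1) + 10) ((length_le_size (h c).2).trans hN)
  simp [Polynomial.eval_comp]
  simp only [size] at *
  omega

theorem foldl {l : γ → List α} {y : γ → β} {f : γ → β → α → β} (hl : PolyTime l) (hy : PolyTime y)
    (hf : PolyTime fun x : γ × β × α => f x.1 x.2.1 x.2.2) (q : Polynomial ℕ)
    (hq : ∀ c l', l' <+: l c → size (l'.foldl (f c) (y c)) ≤ q.eval (size c)) :
    PolyTime fun c => (l c).foldl (f c) (y c) := by
  -- The parameter `c` travels inside the accumulator, since the step of `foldl_of_pair` has access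
  -- to nothing else.
  have key (c : γ) (l' : List α) (z : β) :
      l'.foldl (fun (s : γ × β) (x : α) => (s.1, f s.1 s.2 x)) (c, z) = (c, l'.foldl (f c) z) := by
    induction l' generalizing z with
    | nil => rfl
    | cons x l' ih => exact ih _
  have h := foldl_of_pair (f := fun x : (γ × β) × α => (x.1.1, f x.1.1 x.1.2 x.2))
    (h := fun c => ((c, y c), l c))
    ((fst.comp fst).pair (hf.comp ((fst.comp fst).pair ((snd.comp fst).pair snd))))
    ((id.pair hy).pair hl) (.X + q + 1) (fun c l' hl' => by
      have := hq c l' hl'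
      simp only [key, size_prod, Polynomial.eval_add, Polynomial.eval_X, Polynomial.eval_one]
      omega)
  simpa only [key] using snd.comp h

end PolyTime

/-! ### Turing machines for decision problems -/

open Code Prog

namespace Prog

variable {Γ₀ : Type}

/-- Push a word on stack `a`. -/
def pushWord : List (Option Bool) → Prog (Alph Γ₀)
  | [] => .seq (.push .c none) (.pop .c)
  | x :: w => .seq (pushWord w) (.push .a x)

theorem runs_pushWord (w : List (Option Bool)) (i : List Γ₀) (o : List Bool)
    (a b c e : List (Option Bool)) :
    Runs (pushWord w) (mem i o a b c e) (mem i o (w ++ a) b c e) (w.length + 2) := by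
  induction w with
  | nil =>
    refine (Runs.seq (S' := mem i o a b (none :: c) e) (.push _ _ ?_) (.pop _ ?_)).mono (by simp)
    all_goals simp
  | cons x w ih => exact (Runs.seq ih (.push _ _ (by simp))).mono (by simp)

open Classical in
/-- Pop a symbol from the input, and make its tree the first element of the list on stack `a`. -/
def readSymbol (τ : Γ₀ → BinTree) : List Γ₀ → Prog (Alph Γ₀)
  | [] => .pop .inp
  | x :: l => .ite .inp (fun y => decide (y = some x))
    (.seq (.pop .inp) (pushWord (some true :: (τ x).word))) (readSymbol τ l)

theorem runs_readSymbol (τ : Γ₀ → BinTree) {x : Γ₀} {l : List Γ₀} (hx : x ∈ l) :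
    ∃ n, ∀ i o a b, Runs (readSymbol τ l) (mem (x :: i) o a b [] [])
      (mem i o (some true :: ((τ x).word ++ a)) b [] []) n := by
  induction l with
  | nil => simp at hx
  | cons y l ih =>
    by_cases hxy : x = y
    · subst hxy
      exact ⟨_, fun i o a b => .iteTrue (by simp)
        (.seq (.pop _ (by simp)) (runs_pushWord _ _ _ _ _ _ _))⟩
    · obtain ⟨n, hn⟩ := ih ((List.mem_cons.1 hx).resolve_left hxy)
      exact ⟨n + 1, fun i o a b => .iteFalse (by simp [hxy]) (hn _ _ _ _)⟩

/-- Move the input to stack `a`, as a list in reverse order. -/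
def readInput [Fintype Γ₀] (τ : Γ₀ → BinTree) : Prog (Alph Γ₀) :=
  .seq (.push .a (some false)) (.loop .inp Option.isSome (readSymbol τ Finset.univ.toList))

/-- The cost of reading depends on the symbol only. The alphabet is finite, so the sum of these
costs is a uniform constant per symbol. -/
theorem runs_readInput [Fintype Γ₀] {α : Type} [Code α] (τ : Γ₀ → α) :
    ∃ C, ∀ w : List Γ₀, Runs (readInput fun x => tree (τ x)) (mem w [] [] [] [] [])
      (mem [] [] (tree (w.reverse.map τ)).word [] [] []) (C * w.length + 2) := by
  choose n hn using fun x : Γ₀ =>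
    runs_readSymbol (fun x => tree (τ x)) (x := x) (l := Finset.univ.toList) (by simp)
  have h (w : List Γ₀) (l : List α) :
      Runs (.loop .inp Option.isSome (readSymbol (fun x => tree (τ x)) Finset.univ.toList))
        (mem w [] (tree l).word [] [] [])
        (mem [] [] (tree (w.reverse.map τ ++ l)).word [] [] []) ((∑ x, n x + 1) * w.length + 1) := by
    induction w generalizing l with
    | nil => exact (Runs.loopFalse (by simp)).mono (by simp)
    | cons x w ih =>
      have hx : n x ≤ ∑ x, n x := Finset.single_le_sum (fun _ _ => Nat.zero_le _)
        (Finset.mem_univ x)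
      have ih := ih (τ x :: l)
      have hn := hn x w [] (tree l).word []
      refine (Runs.loopTrue (S' := mem w [] (tree (τ x :: l)).word [] [] []) (by simp)
        (by simpa using hn) (by simpa using ih)).mono ?_
      simp only [List.length_cons, mul_add, mul_one]
      omega
  refine ⟨∑ x, n x + 1, fun w => (Runs.seq (.push _ _ (by simp; rfl))
    (n := (∑ x, n x + 1) * w.length + 1) ?_).mono (by omega)⟩
  simpa using h w []

/-- Move the truth value from stack `a` to the output. -/
def writeOutput : Prog (Alph Γ₀) :=
  .ite .a isNode (.seq (.pop .a) (.seq (.pop .a) (.seq (.pop .a) (.push .out true))))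
    (.seq (.pop .a) (.push .out false))

theorem runs_writeOutput (x : Bool) :
    Runs (writeOutput : Prog (Alph Γ₀)) (mem [] [] (tree x).word [] [] [])
      (mem [] [x] [] [] [] []) 5 := by
  cases x
  · exact (Runs.iteFalse (by simp [isNode]) (.seq (.pop _ (by simp; rfl))
      (.push _ _ (by simp)))).mono (by omega)
  · exact (Runs.iteTrue (by simp [isNode]) (.seq (.pop _ (by simp; rfl))
      (.seq (.pop _ (by simp; rfl)) (.seq (.pop _ (by simp; rfl)) (.push _ _ (by simp)))))).mono
      (by omega)

end Prog

/-- The bridge to `InPTIME`. Reading the input onto a stack reverses it, hence `f` is given the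
reversed word; `τ` translates symbols into coded data. -/
theorem PolyTime.inPTIME {α β Γ₀ : Type} [Code α] [Fintype Γ₀] {enc : β → List Γ₀}
    {P : β → Prop} {f : List α → Bool} (hf : PolyTime f) (τ : Γ₀ → α)
    (h : ∀ x, P x ↔ f ((enc x).reverse.map τ) = true) : InPTIME enc P := by
  classical
  obtain ⟨T, -, hp⟩ := hf
  obtain ⟨p, hp⟩ := hp Γ₀
  obtain ⟨C, hC⟩ := runs_readInput τ
  let p' := Prog.seq (readInput fun x => tree (τ x)) (.seq p writeOutput)
  let B := ∑ x, size (τ x)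
  let q : Polynomial ℕ := (.C C * .X + 2) + (T.comp (.X * .C (B + 1) + 1) + 5) + 1
  have key (x : β) : Nonempty (TM2OutputsInTime (p'.toFinTM2 Stk.inp Stk.out) (enc x)
      (some [decide (P x)]) (q.eval (enc x).length)) := by
    have hB : size ((enc x).reverse.map τ) ≤ (enc x).length * (B + 1) + 1 := by
      refine (size_le_length_mul (B := B) fun y hy => ?_).trans (by simp)
      obtain ⟨z, -, rfl⟩ := List.mem_map.1 hy
      exact Finset.single_le_sum (f := fun x => size (τ x)) (fun _ _ => Nat.zero_le _)
        (Finset.mem_univ z)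
    have h₁ := hp ((enc x).reverse.map τ) [] [] [] []
    simp only [List.append_nil] at h₁
    have h₂ := (hC (enc x)).seq (h₁.seq (runs_writeOutput _))
    have e : decide (P x) = f ((enc x).reverse.map τ) := by
      rw [Bool.eq_iff_iff, decide_eq_true_iff, h]
    have e₁ (w : List Γ₀) : Function.update (fun k => ([] : List (Alph Γ₀ k))) Stk.inp w =
        mem w [] [] [] [] [] := by
      funext k; cases k <;> rfl
    have e₂ (w : List Bool) : Function.update (fun k => ([] : List (Alph Γ₀ k))) Stk.out w =
        mem [] w [] [] [] [] := by
      funext k; cases k <;> rfl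
    have h₃ : Runs p' (Function.update (fun _ => []) Stk.inp (enc x))
        (Function.update (fun _ => []) Stk.out [decide (P x)])
        (((C * (enc x).length + 2)) + (T.eval ((enc x).length * (B + 1) + 1) + 5)) := by
      rw [e₁, e₂, e]
      exact h₂.mono (by have := T.eval_nat_mono hB; simp only at this; omega)
    obtain ⟨h₄⟩ := h₃.outputs
    refine ⟨cast (congrArg _ ?_) h₄⟩
    simp [q, Polynomial.eval_comp]
  exact ⟨{
    tm := p'.toFinTM2 Stk.inp Stk.out
    inputAlphabet := Equiv.refl Γ₀
    outputAlphabet := Equiv.refl Bool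
    time := q
    outputsFun := fun x => by
      refine cast ?_ (key x).some
      congr 1
      · exact (List.map_id _).symm }⟩

/-! ### A library of functions computable in polynomial time -/

open Code Prog

/-- The numbers `s x` are bounded by a polynomial in the size of `x`. -/
def PolyBounded {γ : Type} [Code γ] (s : γ → ℕ) : Prop :=
  ∃ q : Polynomial ℕ, ∀ x, s x ≤ q.eval (size x)

namespace PolyBounded

variable {γ δ : Type} [Code γ] [Code δ] {s t : γ → ℕ}

theorem const (n : ℕ) : PolyBounded fun _ : γ => n := ⟨.C n, fun x => by simp⟩

theorem add (hs : PolyBounded s) (ht : PolyBounded t) : PolyBounded fun x => s x + t x :=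
  let ⟨p, hp⟩ := hs
  let ⟨q, hq⟩ := ht
  ⟨p + q, fun x => by simpa using Nat.add_le_add (hp x) (hq x)⟩

theorem mul (hs : PolyBounded s) (ht : PolyBounded t) : PolyBounded fun x => s x * t x :=
  let ⟨p, hp⟩ := hs
  let ⟨q, hq⟩ := ht
  ⟨p * q, fun x => by simpa using Nat.mul_le_mul (hp x) (hq x)⟩

theorem mono (hs : PolyBounded s) (h : ∀ x, t x ≤ s x) : PolyBounded t :=
  let ⟨p, hp⟩ := hs
  ⟨p, fun x => (h x).trans (hp x)⟩

theorem size {f : γ → δ} (hf : PolyTime f) : PolyBounded fun x => size (f x) :=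
  let ⟨T, hT, _⟩ := hf
  ⟨T, hT⟩

theorem nat {f : γ → ℕ} (hf : PolyTime f) : PolyBounded f :=
  (size hf).mono fun x => by simp; omega

theorem length {f : γ → List δ} (hf : PolyTime f) : PolyBounded fun x => (f x).length :=
  (size hf).mono fun _ => length_le_size _

theorem size_self : PolyBounded fun x : γ => Code.size x := size PolyTime.id

theorem eval (T : Polynomial ℕ) (hs : PolyBounded s) : PolyBounded fun x => T.eval (s x) :=
  let ⟨p, hp⟩ := hs
  ⟨T.comp p, fun x => by simpa [Polynomial.eval_comp] using T.eval_nat_mono (hp x)⟩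

end PolyBounded

namespace PolyTime

variable {α β γ δ : Type} [Code α] [Code β] [Code γ] [Code δ]

theorem foldl' {l : γ → List α} {y : γ → β} {f : γ → β → α → β} (hl : PolyTime l) (hy : PolyTime y)
    (hf : PolyTime fun x : γ × β × α => f x.1 x.2.1 x.2.2) {B : γ → ℕ} (hB : PolyBounded B)
    (h : ∀ c l', l' <+: l c → size (l'.foldl (f c) (y c)) ≤ B c) :
    PolyTime fun c => (l c).foldl (f c) (y c) :=
  let ⟨q, hq⟩ := hB
  foldl hl hy hf q fun c l' hl' => (h c l' hl').trans (hq c)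

theorem not {f : γ → Bool} (hf : PolyTime f) : PolyTime fun x => !f x :=
  of_tree_eq_tree (hf.cond (const false) (const true)) fun x => by cases f x <;> rfl

theorem and {f g : γ → Bool} (hf : PolyTime f) (hg : PolyTime g) : PolyTime fun x => f x && g x :=
  of_tree_eq_tree (hf.cond hg (const false)) fun x => by cases f x <;> rfl

theorem or {f g : γ → Bool} (hf : PolyTime f) (hg : PolyTime g) : PolyTime fun x => f x || g x :=
  of_tree_eq_tree (hf.cond (const true) hg) fun x => by cases f x <;> rfl

theorem cons {f : γ → α} {l : γ → List α} (hf : PolyTime f) (hl : PolyTime l) :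
    PolyTime fun x => f x :: l x :=
  of_tree_eq_tree (hf.pair hl) fun _ => rfl

theorem succ {n : γ → ℕ} (hn : PolyTime n) : PolyTime fun x => n x + 1 :=
  of_tree_eq_tree ((const ()).pair hn) fun _ => rfl

/-- A number has the same code as a list of that many units, which turns iteration into a fold. -/
theorem replicate_unit {n : γ → ℕ} (hn : PolyTime n) :
    PolyTime fun x => List.replicate (n x) () :=
  of_tree_eq_tree hn fun x => by
    induction n x with
    | zero => rfl
    | succ n ih => simp [List.replicate_succ, ih]

/-- The subtrees of a tree. -/
def children : BinTree → BinTree × BinTree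
  | .leaf => (.leaf, .leaf)
  | .node l r => (l, r)

/-- A node already is the code of the pair of its subtrees. A leaf becomes the code of a pair of
leaves by pushing two symbols. -/
theorem children' : PolyTime children := by
  refine of_le (.X + 2) (.X + 5) (fun t => ?_) fun Γ₀ => ⟨.ite .a isNode
    (.seq (.push .c none) (.pop .c)) (.seq (.push .a (some false)) (.push .a (some true))), ?_⟩
  · cases t <;> simp [size, children]
  · intro t i o a b
    cases t
    · exact (Runs.iteFalse (by simp [isNode]) (.seq (.push _ _ (by simp; rfl))
        (.push _ _ (by simp [children])))).mono (by simp)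
    · exact (Runs.iteTrue (by simp [isNode]) (.seq (.push _ _ rfl)
        (.pop _ (by simp [children])))).mono (by simp)

theorem tail {l : γ → List α} (hl : PolyTime l) : PolyTime fun x => (l x).tail :=
  of_tree_eq_tree (snd.comp (children'.comp (of_tree_eq_tree (f := fun x => tree (l x)) hl
    fun _ => rfl))) fun x => by cases l x <;> rfl

theorem isEmpty {l : γ → List α} (hl : PolyTime l) : PolyTime fun x => (l x).isEmpty := by
  have h := foldl' (f := fun (_ : γ) (_ : Bool) (_ : α) => false) hl (const true) (const false)
    (.const 3) (fun c l' _ => size_bool_le _)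
  have e (b : Bool) (l : List α) : l.foldl (fun (_ : Bool) (_ : α) => false) b =
      bif l.isEmpty then b else false := by
    induction l generalizing b with
    | nil => rfl
    | cons x l ih => rw [List.foldl_cons, ih]; cases l <;> rfl
  simpa [e] using h

theorem headD {l : γ → List α} {d : γ → α} (hl : PolyTime l) (hd : PolyTime d) :
    PolyTime fun x => (l x).headD (d x) :=
  of_tree_eq_tree (hl.isEmpty.cond (f := fun x => tree (d x))
    (of_tree_eq_tree hd fun _ => rfl)
    (fst.comp (children'.comp (of_tree_eq_tree (f := fun x => tree (l x)) hl fun _ => rfl))))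
    fun x => by cases l x <;> rfl

theorem reverse {l : γ → List α} (hl : PolyTime l) : PolyTime fun x => (l x).reverse := by
  have e (l : List α) (l' : List α) : l.foldl (fun l x => x :: l) l' = l.reverse ++ l' := by
    induction l generalizing l' with
    | nil => rfl
    | cons x l ih => simp [ih]
  have h := foldl' (f := fun (_ : γ) (l : List α) (x : α) => x :: l) hl (const [])
    ((snd.comp snd).cons (fst.comp snd)) (.size hl) (fun c l' hl' => by
      simpa [e, size_reverse] using size_le_of_prefix hl')
  simpa [e] using h

/-- The fold collects the values in reverse order. Every value has size polynomial in `c` and the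
list, so the intermediate lists do as well. -/
theorem map {l : γ → List α} {f : γ → α → β} (hl : PolyTime l)
    (hf : PolyTime fun x : γ × α => f x.1 x.2) : PolyTime fun x => (l x).map (f x) := by
  have e (c : γ) (l : List α) (l' : List β) :
      l.foldl (fun l x => f c x :: l) l' = (l.map (f c)).reverse ++ l' := by
    induction l generalizing l' with
    | nil => rfl
    | cons x l ih => simp [ih]
  obtain ⟨T, hT⟩ := PolyBounded.size hf
  have h := foldl' (f := fun (c : γ) (l : List β) (x : α) => f c x :: l) hl (const [])
    ((hf.comp (fst.pair (snd.comp snd))).cons (fst.comp snd))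
    (((PolyBounded.length hl).mul ((PolyBounded.eval T ((PolyBounded.size_self.add
      (.size hl)).add (.const 1))).add (.const 1))).add (.const 1)) (fun c l' hl' => by
      rw [e, List.append_nil, size_reverse]
      refine (size_le_length_mul (B := T.eval (size c + size (l c) + 1)) fun y hy => ?_).trans ?_
      · obtain ⟨x, hx, rfl⟩ := List.mem_map.1 hy
        have := size_le_of_mem (hl'.subset hx)
        exact (hT (c, x)).trans (T.eval_nat_mono (by simp; omega))
      · rw [List.length_map]
        gcongr
        exact hl'.length_le)
  simpa [e] using h.reverse

theorem any {l : γ → List α} {p : γ → α → Bool} (hl : PolyTime l)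
    (hp : PolyTime fun x : γ × α => p x.1 x.2) : PolyTime fun x => (l x).any (p x) := by
  have e (c : γ) (l : List α) (b : Bool) :
      l.foldl (fun b x => b || p c x) b = (b || l.any (p c)) := by
    induction l generalizing b with
    | nil => simp
    | cons x l ih => simp [ih, Bool.or_assoc]
  have h := foldl' (f := fun (c : γ) (b : Bool) (x : α) => b || p c x) hl (const false)
    ((fst.comp snd).or (hp.comp (fst.pair (snd.comp snd)))) (.const 3)
    (fun c l' _ => size_bool_le _)
  simpa [e] using h

theorem length {l : γ → List α} (hl : PolyTime l) : PolyTime fun x => (l x).length := by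
  have h := foldl' (f := fun (_ : γ) (n : ℕ) (_ : α) => n + 1) hl (const 0)
    (fst.comp snd).succ (((PolyBounded.length hl).mul (.const 2)).add (.const 1)) (fun c l' hl' => by
      have := hl'.length_le
      simp; omega)
  simpa using h

theorem iterate {n : γ → ℕ} {y : γ → β} {f : γ → β → β} (hn : PolyTime n) (hy : PolyTime y)
    (hf : PolyTime fun x : γ × β => f x.1 x.2) {B : γ → ℕ} (hB : PolyBounded B)
    (h : ∀ c k, k ≤ n c → size ((f c)^[k] (y c)) ≤ B c) : PolyTime fun c => (f c)^[n c] (y c) := by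
  have e (c : γ) (l : List Unit) (y : β) :
      l.foldl (fun y (_ : Unit) => f c y) y = (f c)^[l.length] y := by
    induction l generalizing y with
    | nil => rfl
    | cons x l ih => simp [ih]
  have h := foldl' (f := fun (c : γ) (y : β) (_ : Unit) => f c y) hn.replicate_unit hy
    (hf.comp (fst.pair (fst.comp snd))) hB (fun c l' hl' => by
      rw [e]
      exact h _ _ (by simpa using hl'.length_le))
  simpa [e] using h

theorem range {n : γ → ℕ} (hn : PolyTime n) : PolyTime fun x => List.range (n x) := by
  have e (k : ℕ) : (fun l : List ℕ => l.length :: l)^[k] [] = (List.range k).reverse := by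
    induction k with
    | zero => rfl
    | succ k ih => rw [Function.iterate_succ_apply', ih]; simp [List.range_succ]
  have h := iterate (f := fun (_ : γ) (l : List ℕ) => l.length :: l) hn (const [])
    (snd.length.cons snd) (((PolyBounded.nat hn).mul (((PolyBounded.nat hn).mul
      (.const 2)).add (.const 2))).add (.const 1)) (fun c k hk => by
      rw [e, size_reverse]
      refine (size_le_length_mul (B := n c * 2 + 1) fun x hx => ?_).trans ?_
      · have := List.mem_range.1 hx
        simp; omega
      · rw [List.length_range]
        gcongr)
  simpa [e] using h.reverse

theorem add {m n : γ → ℕ} (hm : PolyTime m) (hn : PolyTime n) : PolyTime fun x => m x + n x := by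
  have h := iterate (f := fun (_ : γ) (k : ℕ) => k + 1) hn hm snd.succ
    (B := fun c => 2 * (m c + n c) + 1)
    (((PolyBounded.const 2).mul ((PolyBounded.nat hm).add (.nat hn))).add (.const 1))
    (fun c k hk => by simp; omega)
  simpa using h

theorem drop {l : γ → List α} {n : γ → ℕ} (hl : PolyTime l) (hn : PolyTime n) :
    PolyTime fun x => (l x).drop (n x) := by
  have e (k : ℕ) (l : List α) : List.tail^[k] l = l.drop k := by
    induction k generalizing l with
    | zero => rfl
    | succ k ih => rw [Function.iterate_succ_apply, ih, List.drop_tail]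
  have h := iterate (f := fun (_ : γ) (l : List α) => l.tail) hn hl snd.tail
    (.size hl) (fun c k hk => by
      rw [e]
      exact size_le_of_suffix (List.drop_suffix _ _))
  simpa only [e] using h

theorem getD {l : γ → List α} {n : γ → ℕ} {d : γ → α} (hl : PolyTime l) (hn : PolyTime n)
    (hd : PolyTime d) : PolyTime fun x => (l x).getD (n x) (d x) := by
  have h := (hl.drop hn).headD hd
  simpa [List.headD_eq_head?_getD, List.head?_drop] using h

end PolyTime

/-! ### Decision procedures on bit vectors -/

namespace AttackTree

/-- The bit vector of length `m` of a set of states. -/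
def vec (m : ℕ) (f : ℕ → Bool) : List Bool := (List.range m).map f

/-- The bit of a vector at a state. -/
def bit (v : List Bool) (s : ℕ) : Bool := v.getD s false

/-- The successors of the states in `v`, for the adjacency matrix `E`. -/
def post (m : ℕ) (E : List (List Bool)) (v : List Bool) : List Bool :=
  vec m fun t => (List.range m).any fun s => bit v s && bit (E.getD s []) t

/-- The states that are reachable from `v` on paths that avoid `A`. -/
def reach (m : ℕ) (E : List (List Bool)) (v A : List Bool) : List Bool :=
  (fun X => vec m fun t => bit X t || (bit (post m E X) t && !bit A t))^[m]
    (vec m fun t => bit v t && !bit A t)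

/-- The vectors `v` and `w` have a state in common. -/
def meets (m : ℕ) (v w : List Bool) : Bool := (List.range m).any fun s => bit v s && bit w s

/-- The bit vector of the state `s`. -/
def single (s : ℕ) : List Bool := (List.cons false)^[s] [true]

/-- The transition system and the goals of an input: the number of states, the rows of the adjacency
matrix, and the bit vectors of the propositions of the main goal and of the subgoals. -/
abbrev Data : Type :=
  ℕ × List (List Bool) × List Bool × List Bool × List (List Bool × List Bool)

namespace Data

/-- The number of states. -/
def num (x : Data) : ℕ := x.1
/-- The rows of the adjacency matrix. -/
def adj (x : Data) : List (List Bool) := x.2.1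
/-- The states with which the paths of the main goal start. -/
def src (x : Data) : List Bool := x.2.2.1
/-- The states with which the paths of the main goal end. -/
def tgt (x : Data) : List Bool := x.2.2.2.1
/-- The subgoals. -/
def goals (x : Data) : List (List Bool × List Bool) := x.2.2.2.2

/-- The states that are reachable from `v` on paths that avoid `A`. -/
def reach (x : Data) (v A : List Bool) : List Bool := AttackTree.reach x.num x.adj v A

/-- Over-Match for `OR`. -/
def matchOr (x : Data) : Bool :=
  !(List.range x.num).any fun s => bit x.src s &&
    (List.range x.num).any fun t => bit x.tgt t && bit (x.reach (single s) []) t &&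
      !x.goals.any fun p => bit p.1 s && bit p.2 t

/-- One step in the construction of a path that does not match a `SAND`. The state consists of the
target of the last subgoal, the set of states at which a path may pass to the next subgoal for the
first time, and the information whether a path that does not match has been found. -/
def sandStep (x : Data) (st : List Bool × List Bool × Bool) (p : List Bool × List Bool) :
    List Bool × List Bool × Bool :=
  (p.2,
    vec x.num fun t => (bit st.1 t && bit p.1 t) && (bit st.2.1 t || bit (post x.num x.adj
      (x.reach st.2.1 (vec x.num fun t => bit st.1 t && bit p.1 t))) t),
    st.2.2 || meets x.num (x.reach st.2.1 (vec x.num fun t => bit st.1 t && bit p.1 t)) x.tgt)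

/-- Over-Match for `SAND`. -/
def matchSand (x : Data) : Bool :=
  !((x.goals.tail.foldl x.sandStep ((x.goals.headD ([], [])).2, x.src, false)).2.2 ||
    meets x.num (x.reach
      (vec x.num fun t => bit x.src t && !bit (x.goals.headD ([], [])).1 t) []) x.tgt ||
    meets x.num (x.reach x.src []) (vec x.num fun t => bit x.tgt t &&
      !bit (x.goals.tail.foldl x.sandStep ((x.goals.headD ([], [])).2, x.src, false)).1 t))

/-- Some path of the main goal has a proper prefix that avoids `U`, and the rest avoids `W`. -/
def split (x : Data) (U W : List Bool) : Bool :=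
  meets x.num (x.reach (post x.num x.adj (x.reach x.src U)) W) x.tgt

/-- Some path of the main goal does not match the `AND`, and if this is so because of a transition
that is not covered, then the certificate `w` is the set of the subgoals whose sources do not occur
before that transition. -/
def mismatchAnd (x : Data) (w : List Bool) : Bool :=
  (x.goals.any fun p => meets x.num (x.reach x.src p.1) x.tgt ||
    meets x.num (x.reach x.src p.2) x.tgt || x.split p.1 p.2) ||
  x.split
    (vec x.num fun t => (List.range x.goals.length).any fun k =>
      bit w k && bit (x.goals.getD k ([], [])).1 t)
    (vec x.num fun t => (List.range x.goals.length).any fun k =>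
      !bit w k && bit (x.goals.getD k ([], [])).2 t)

end Data

/-! ### Recovering the data from the word -/

/-- The pairs of consecutive elements of a list, in reverse order, and the rest. -/
def pairStep {α : Type} (st : List α × List (α × α)) (a : α) : List α × List (α × α) :=
  bif st.1.isEmpty then ([a], st.2) else ([], (st.1.headD a, a) :: st.2)

/-- The bit vector of a proposition in a list of blocks. -/
def blockLabel (bs : List (List Bool)) (a : ℕ) : List Bool :=
  bs.getD (a + ((bs.getD 0 []).length + 2)) []

/-- The position of the main goal in a list of blocks. -/
def blockGoal (bs : List (List Bool)) : ℕ :=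
  (bs.getD 1 []).length + ((bs.getD 0 []).length + 2)

/-- The data in a list of blocks. -/
def blockData (bs : List (List Bool)) : Data :=
  ((bs.getD 0 []).length, (List.range (bs.getD 0 []).length).map (fun s => bs.getD (s + 2) []),
    blockLabel bs (bs.getD (blockGoal bs) []).length,
    blockLabel bs (bs.getD (blockGoal bs + 1) []).length,
    ((bs.drop (blockGoal bs + 2)).foldl pairStep ([], [])).2.reverse.map fun q =>
      (blockLabel bs q.1.length, blockLabel bs q.2.length))

/-- One step of reading a word from its end: `(true, _, x)` is the bit `x` of a certificate,
`(false, true, _)` is the end of a block, and `(false, false, x)` is the bit `x` of a block. -/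
def readStep (st : List (List Bool) × List Bool) (y : Bool × Bool × Bool) :
    List (List Bool) × List Bool :=
  bif y.1 then (st.1, y.2.2 :: st.2)
  else bif y.2.1 then ([] :: st.1, st.2)
  else ((y.2.2 :: st.1.headD []) :: st.1.tail, st.2)

/-- The blocks and the certificate in a word that is given in reverse order. -/
def readWord (l : List (Bool × Bool × Bool)) : List (List Bool) × List Bool :=
  l.foldl readStep ([], [])

/-! ### Polynomial running time of the decision procedures -/

open Code PolyTime

variable {γ : Type} [Code γ]

theorem size_vec_le (m : ℕ) (f : ℕ → Bool) : size (vec m f) ≤ m * 4 + 1 := by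
  simpa [vec] using size_le_length_mul (l := vec m f) (B := 3) fun x _ => size_bool_le x

theorem polyTime_bit {v : γ → List Bool} {s : γ → ℕ} (hv : PolyTime v) (hs : PolyTime s) :
    PolyTime fun x => bit (v x) (s x) :=
  hv.getD hs (const false)

theorem polyTime_vec {m : γ → ℕ} {f : γ → ℕ → Bool} (hm : PolyTime m)
    (hf : PolyTime fun x : γ × ℕ => f x.1 x.2) : PolyTime fun x => vec (m x) (f x) :=
  hm.range.map hf

theorem polyTime_post {m : γ → ℕ} {E : γ → List (List Bool)} {v : γ → List Bool} (hm : PolyTime m)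
    (hE : PolyTime E) (hv : PolyTime v) : PolyTime fun x => post (m x) (E x) (v x) :=
  polyTime_vec hm ((hm.comp fst).range.any (.and (polyTime_bit (hv.comp (fst.comp fst)) snd)
    (polyTime_bit ((hE.comp (fst.comp fst)).getD snd (const [])) (snd.comp fst))))

theorem polyTime_reach {m : γ → ℕ} {E : γ → List (List Bool)} {v A : γ → List Bool}
    (hm : PolyTime m) (hE : PolyTime E) (hv : PolyTime v) (hA : PolyTime A) :
    PolyTime fun x => reach (m x) (E x) (v x) (A x) := by
  refine iterate hm (polyTime_vec hm ((polyTime_bit (hv.comp fst) snd).and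
    (polyTime_bit (hA.comp fst) snd).not)) (polyTime_vec (hm.comp fst)
      ((polyTime_bit (snd.comp fst) snd).or ((polyTime_bit (polyTime_post (hm.comp (fst.comp fst))
        (hE.comp (fst.comp fst)) (snd.comp fst)) snd).and
        (polyTime_bit (hA.comp (fst.comp fst)) snd).not)))
    -- Every iterate is a bit vector of length `m`, so the sets do not grow in size at all.
    (((PolyBounded.nat hm).mul (.const 4)).add (.const 1)) fun c k _ => ?_
  cases k with
  | zero => exact size_vec_le _ _
  | succ k => rw [Function.iterate_succ_apply']; exact size_vec_le _ _

theorem polyTime_meets {m : γ → ℕ} {v w : γ → List Bool} (hm : PolyTime m) (hv : PolyTime v)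
    (hw : PolyTime w) : PolyTime fun x => meets (m x) (v x) (w x) :=
  hm.range.any ((polyTime_bit (hv.comp fst) snd).and (polyTime_bit (hw.comp fst) snd))

theorem polyTime_single {s : γ → ℕ} (hs : PolyTime s) : PolyTime fun x => single (s x) := by
  refine iterate hs (const [true]) ((const false).cons snd)
    (((PolyBounded.nat hs).mul (.const 2)).add (.const 5)) fun c k hk => ?_
  have h (k : ℕ) : size ((List.cons false)^[k] [true]) = 2 * k + 5 := by
    induction k with
    | zero => rfl
    | succ k ih =>
      rw [Function.iterate_succ_apply', size_cons, ih]
      simp [size]; omega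
  rw [h]; omega

namespace Data

theorem polyTime_num {x : γ → Data} (hx : PolyTime x) : PolyTime fun c => (x c).num := fst.comp hx
theorem polyTime_adj {x : γ → Data} (hx : PolyTime x) : PolyTime fun c => (x c).adj :=
  fst.comp (snd.comp hx)
theorem polyTime_src {x : γ → Data} (hx : PolyTime x) : PolyTime fun c => (x c).src :=
  fst.comp (snd.comp (snd.comp hx))
theorem polyTime_tgt {x : γ → Data} (hx : PolyTime x) : PolyTime fun c => (x c).tgt :=
  fst.comp (snd.comp (snd.comp (snd.comp hx)))
theorem polyTime_goals {x : γ → Data} (hx : PolyTime x) : PolyTime fun c => (x c).goals :=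
  snd.comp (snd.comp (snd.comp (snd.comp hx)))

theorem polyTime_reach {x : γ → Data} {v A : γ → List Bool} (hx : PolyTime x) (hv : PolyTime v)
    (hA : PolyTime A) : PolyTime fun c => (x c).reach (v c) (A c) :=
  AttackTree.polyTime_reach (polyTime_num hx) (polyTime_adj hx) hv hA

theorem polyTime_matchOr : PolyTime matchOr := by
  refine not (any (polyTime_num .id).range (and (polyTime_bit (polyTime_src fst) snd)
    (any (polyTime_num fst).range (and (and (polyTime_bit (polyTime_tgt (fst.comp fst)) snd)
      (polyTime_bit (polyTime_reach (fst.comp fst) (polyTime_single (snd.comp fst))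
        (const [])) snd)) (not (any (polyTime_goals (fst.comp fst)) (and ?_ ?_)))))))
  · exact polyTime_bit (fst.comp snd) (snd.comp (fst.comp fst))
  · exact polyTime_bit (snd.comp snd) (snd.comp fst)

theorem polyTime_sandFold : PolyTime fun x : Data =>
    x.goals.tail.foldl x.sandStep ((x.goals.headD ([], [])).2, x.src, false) := by
  have hg : PolyTime goals := polyTime_goals .id
  have hA : PolyTime fun y : Data × (List Bool × List Bool × Bool) × (List Bool × List Bool) =>
      vec y.1.num fun t => bit y.2.1.1 t && bit y.2.2.1 t :=
    polyTime_vec (polyTime_num fst)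
      (and (polyTime_bit ((fst.comp (fst.comp snd)).comp fst) snd)
        (polyTime_bit ((fst.comp (snd.comp snd)).comp fst) snd))
  have hR := polyTime_reach fst (fst.comp (snd.comp (fst.comp snd))) hA
  refine foldl' hg.tail (pair (snd.comp (hg.headD (const _))) (pair (polyTime_src .id)
    (const false))) (pair (snd.comp (snd.comp snd)) (pair (polyTime_vec (polyTime_num fst)
      (and (and (polyTime_bit ((fst.comp (fst.comp snd)).comp fst) snd)
        (polyTime_bit ((fst.comp (snd.comp snd)).comp fst) snd))
        (or (polyTime_bit ((fst.comp (snd.comp (fst.comp snd))).comp fst) snd)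
          (polyTime_bit ((polyTime_post (polyTime_num fst) (polyTime_adj fst) hR).comp fst) snd))))
      (or (snd.comp (snd.comp (fst.comp snd)))
        (polyTime_meets (polyTime_num fst) hR (polyTime_tgt fst)))))
    (B := fun x => size x.goals + size (x.goals.headD ([], [])).2 + size x.src + x.num * 4 + 10)
    ((((PolyBounded.size hg).add (.size (snd.comp (hg.headD (const _))))).add
      (.size (polyTime_src .id))).add ((PolyBounded.nat (polyTime_num .id)).mul (.const 4)) |>.add
      (.const 10)) fun x l hl => ?_
  -- Only the last step counts: whatever the state before it, the new one consists of a component of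
  -- a subgoal, a vector with one bit per state, and a truth value.
  rcases List.eq_nil_or_concat l with rfl | ⟨l, p, rfl⟩
  · have := size_bool_le false
    simp; omega
  · have hp : size p ≤ size x.goals :=
      size_le_of_mem (List.mem_of_mem_tail (hl.subset (by simp)))
    rw [List.concat_eq_append, List.foldl_append, List.foldl_cons, List.foldl_nil]
    generalize List.foldl x.sandStep _ l = st
    simp only [sandStep, size_prod] at hp ⊢
    have h₁ := size_vec_le x.num fun t => (bit st.1 t && bit p.1 t) && (bit st.2.1 t ||
      bit (post x.num x.adj (x.reach st.2.1 (vec x.num fun t => bit st.1 t && bit p.1 t))) t)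
    have h₂ := size_bool_le (st.2.2 || meets x.num
      (x.reach st.2.1 (vec x.num fun t => bit st.1 t && bit p.1 t)) x.tgt)
    omega

theorem polyTime_matchSand : PolyTime matchSand := by
  have hg : PolyTime goals := polyTime_goals .id
  have hs : PolyTime src := polyTime_src .id
  have ht : PolyTime tgt := polyTime_tgt .id
  have hn : PolyTime num := polyTime_num .id
  have hf := polyTime_sandFold
  refine not (or (or (snd.comp (snd.comp hf)) (polyTime_meets hn (polyTime_reach .id
    (polyTime_vec hn ?_) (const [])) ht)) (polyTime_meets hn (polyTime_reach .id hs (const []))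
      (polyTime_vec hn ?_)))
  · exact and (polyTime_bit (hs.comp fst) snd)
      (not (polyTime_bit ((fst.comp (hg.headD (const _))).comp fst) snd))
  · exact and (polyTime_bit (ht.comp fst) snd) (not (polyTime_bit ((fst.comp hf).comp fst) snd))

theorem polyTime_split {x : γ → Data} {U W : γ → List Bool} (hx : PolyTime x) (hU : PolyTime U)
    (hW : PolyTime W) : PolyTime fun c => (x c).split (U c) (W c) :=
  polyTime_meets (polyTime_num hx) (polyTime_reach hx (polyTime_post (polyTime_num hx)
    (polyTime_adj hx) (polyTime_reach hx (polyTime_src hx) hU)) hW) (polyTime_tgt hx)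

theorem polyTime_mismatchAnd : PolyTime fun y : Data × List Bool => y.1.mismatchAnd y.2 := by
  have hg : PolyTime fun y : Data × List Bool => y.1.goals := polyTime_goals fst
  have hw : PolyTime fun z : ((Data × List Bool) × ℕ) × ℕ => bit z.1.1.2 z.2 :=
    polyTime_bit (snd.comp (fst.comp fst)) snd
  have hp : PolyTime fun z : ((Data × List Bool) × ℕ) × ℕ => z.1.1.1.goals.getD z.2 ([], []) :=
    getD (hg.comp (fst.comp fst)) snd (const _)
  have ht : PolyTime fun z : ((Data × List Bool) × ℕ) × ℕ => z.1.2 := snd.comp fst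
  refine or (any hg ?_) (polyTime_split fst (polyTime_vec (polyTime_num fst)
    (any (hg.length.range.comp fst) (and hw (polyTime_bit (fst.comp hp) ht))))
    (polyTime_vec (polyTime_num fst)
    (any (hg.length.range.comp fst) (and (not hw) (polyTime_bit (snd.comp hp) ht)))))
  have hx : PolyTime fun z : (Data × List Bool) × (List Bool × List Bool) => z.1.1 := fst.comp fst
  have h (f : List Bool × List Bool → List Bool) (hf : PolyTime f) :
      PolyTime fun z : (Data × List Bool) × (List Bool × List Bool) =>
        meets z.1.1.num (z.1.1.reach z.1.1.src (f z.2)) z.1.1.tgt :=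
    polyTime_meets (polyTime_num hx) (polyTime_reach hx (polyTime_src hx) (hf.comp snd))
      (polyTime_tgt hx)
  exact or (or (h _ fst) (h _ snd)) (polyTime_split hx (fst.comp snd) (snd.comp snd))

end Data

theorem polyTime_pairs {α : Type} [Code α] {l : γ → List α} (hl : PolyTime l) :
    PolyTime fun x => (l x).foldl pairStep ([], []) := by
  refine foldl' (f := fun (_ : γ) (st : List α × List (α × α)) a => pairStep st a) hl (const _)
    (cond (isEmpty (fst.comp (fst.comp snd)))
      (pair (cons (snd.comp snd) (const [])) (snd.comp (fst.comp snd)))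
      (pair (const []) (cons (pair (headD (fst.comp (fst.comp snd)) (snd.comp snd)) (snd.comp snd))
        (snd.comp (fst.comp snd)))))
    (B := fun x => size (l x) + 2) ((PolyBounded.size hl).add (.const 2)) fun c l' hl' => ?_
  -- Each element adds at most its own size plus one to the state.
  have h (l : List α) (st : List α × List (α × α)) :
      size (l.foldl pairStep st) + 1 ≤ size st + size l := by
    induction l generalizing st with
    | nil => simp
    | cons a l ih =>
      refine (ih _).trans ?_
      obtain ⟨_ | ⟨y, p⟩, o⟩ := st
      · simp [pairStep]; omega
      · have := size_pos p
        simp [pairStep]; omega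
  have h₁ := h l' ([], [])
  have h₂ := size_le_of_prefix hl'
  change size (l'.foldl pairStep ([], [])) ≤ _
  simp at h₁ ⊢
  omega

theorem polyTime_blockData : PolyTime blockData := by
  have h₀ (k : ℕ) : PolyTime fun bs : List (List Bool) => (bs.getD k []).length :=
    length (getD .id (const k) (const []))
  have hL {γ : Type} [Code γ] {bs : γ → List (List Bool)} {a : γ → ℕ} (hb : PolyTime bs)
      (ha : PolyTime a) : PolyTime fun x => blockLabel (bs x) (a x) :=
    getD hb (add ha (succ (succ ((h₀ 0).comp hb)))) (const [])
  have hG : PolyTime blockGoal := add (h₀ 1) (succ (succ (h₀ 0)))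
  refine pair (h₀ 0) (pair (map (h₀ 0).range (getD fst (succ (succ snd)) (const [])))
    (pair (hL .id (length (getD .id hG (const []))))
      (pair (hL .id (length (getD .id hG.succ (const []))))
        (map (reverse (snd.comp (polyTime_pairs (drop .id hG.succ.succ)))) (pair ?_ ?_)))))
  · exact hL fst (length (fst.comp snd))
  · exact hL fst (length (snd.comp snd))

theorem polyTime_readWord : PolyTime readWord := by
  refine foldl' (f := fun (_ : List (Bool × Bool × Bool)) st y => readStep st y) .id (const _)
    (cond (fst.comp (snd.comp snd))
      (pair (fst.comp (fst.comp snd)) (cons (snd.comp (snd.comp (snd.comp snd)))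
        (snd.comp (fst.comp snd))))
      (cond (fst.comp (snd.comp (snd.comp snd)))
        (pair (cons (const []) (fst.comp (fst.comp snd))) (snd.comp (fst.comp snd)))
        (pair (cons (cons (snd.comp (snd.comp (snd.comp snd))) (headD (fst.comp (fst.comp snd))
          (const []))) (tail (fst.comp (fst.comp snd)))) (snd.comp (fst.comp snd)))))
    (B := fun l => l.length * 6 + 3) (((PolyBounded.length .id).mul (.const 6)).add (.const 3))
    fun c l' hl' => ?_
  -- The most expensive symbol is a bit that opens a new block: an entry for the block, an entry for
  -- the bit, and the bit itself.
  have h (l : List (Bool × Bool × Bool)) (st : List (List Bool) × List Bool) :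
      size (l.foldl readStep st) ≤ size st + l.length * 6 := by
    induction l generalizing st with
    | nil => simp
    | cons y l ih =>
      refine (ih _).trans ?_
      have := size_bool_le y.2.2
      obtain ⟨x, z, y⟩ := y
      obtain ⟨_ | ⟨b, bs⟩, w⟩ := st <;> cases x <;> cases z <;> simp [readStep] at this ⊢ <;> omega
  have h₁ := h l' ([], [])
  have h₂ := hl'.length_le
  change size (l'.foldl readStep ([], [])) ≤ _
  simp at h₁ ⊢
  omega

end AttackTree

/-! ### Walks -/

namespace AttackTree

section Walks

variable {S : Type} {R : S → S → Prop}

/-- The states `f 0, …, f n` form a path. -/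
def IsWalk (R : S → S → Prop) (f : ℕ → S) (n : ℕ) : Prop := ∀ i < n, R (f i) (f (i + 1))

theorem IsWalk.mono {f : ℕ → S} {m n : ℕ} (h : IsWalk R f n) (hmn : m ≤ n) : IsWalk R f m :=
  fun i hi => h i (by omega)

theorem IsWalk.shift {f : ℕ → S} {n : ℕ} (h : IsWalk R f n) (k : ℕ) :
    IsWalk R (fun i => f (k + i)) (n - k) :=
  fun i hi => h (k + i) (by omega)

theorem IsWalk.glue {f g : ℕ → S} {m n : ℕ} (hf : IsWalk R f m) (hg : IsWalk R g n)
    (h : R (f m) (g 0)) : ∃ w, IsWalk R w (m + 1 + n) ∧ (∀ i ≤ m, w i = f i) ∧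
      ∀ i, w (m + 1 + i) = g i := by
  obtain ⟨w, h₁, h₂⟩ : ∃ w : ℕ → S, (∀ i ≤ m, w i = f i) ∧ ∀ i, w (m + 1 + i) = g i :=
    ⟨fun i => if i ≤ m then f i else g (i - (m + 1)), fun i hi => if_pos hi, fun i =>
      (if_neg (by omega)).trans (by rw [Nat.add_sub_cancel_left])⟩
  refine ⟨w, fun i hi => ?_, h₁, h₂⟩
  rcases lt_trichotomy i m with him | rfl | him
  · rw [h₁ i him.le, h₁ (i + 1) him]; exact hf i him
  · rw [h₁ i le_rfl, show i + 1 = i + 1 + 0 from rfl, h₂]; exact h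
  · obtain ⟨j, rfl⟩ := Nat.exists_eq_add_of_le (show m + 1 ≤ i from him)
    rw [h₂, show m + 1 + j + 1 = m + 1 + (j + 1) from rfl, h₂]
    exact hg j (by omega)

/-- The states that are reachable from `B` on walks that avoid `A`. -/
def Reach (R : S → S → Prop) (B A : Set S) : Set S :=
  {t | ∃ f n, IsWalk R f n ∧ f 0 ∈ B ∧ f n = t ∧ ∀ i ≤ n, f i ∉ A}

/-- The successors of the states in `B`. -/
def Post (R : S → S → Prop) (B : Set S) : Set S := {t | ∃ s ∈ B, R s t}

/-- With the next two lemmas, this makes `Reach R B A` the least set that contains `B \ A` and is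
closed under successors outside `A`. -/
theorem reach_subset {B A C : Set S} (h : B \ A ⊆ C) (h' : Post R C \ A ⊆ C) :
    Reach R B A ⊆ C := by
  rintro t ⟨f, n, hf, h₀, rfl, hA⟩
  have key : ∀ i ≤ n, f i ∈ C := by
    intro i
    induction i with
    | zero => exact fun _ => h ⟨h₀, hA 0 (Nat.zero_le _)⟩
    | succ i ih => exact fun hi => h' ⟨⟨f i, ih (by omega), hf i hi⟩, hA _ hi⟩
  exact key n le_rfl

theorem diff_subset_reach {B A : Set S} : B \ A ⊆ Reach R B A :=
  fun s hs => ⟨fun _ => s, 0, fun i hi => by omega, hs.1, rfl, fun _ _ => hs.2⟩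

theorem post_reach_diff_subset {B A : Set S} : Post R (Reach R B A) \ A ⊆ Reach R B A := by
  rintro t ⟨⟨s, ⟨f, n, hf, h₀, rfl, hA⟩, hst⟩, ht⟩
  obtain ⟨w, hw, h₁, h₂⟩ := hf.glue (g := fun _ => t) (n := 0) (fun i hi => by omega) hst
  refine ⟨w, n + 1 + 0, hw, by rwa [h₁ 0 (Nat.zero_le _)], h₂ 0, fun i hi => ?_⟩
  rcases Nat.lt_or_ge n i with hi' | hi'
  · obtain rfl : i = n + 1 + 0 := by omega
    rwa [h₂ 0]
  · rw [h₁ i hi']; exact hA i hi'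

theorem iterate_eq_reach [Fintype S] (B A : Set S) :
    (fun X => X ∪ (Post R X \ A))^[Fintype.card S] (B \ A) = Reach R B A := by
  set F : Set S → Set S := fun X => X ∪ (Post R X \ A) with hF
  -- As long as the increasing chain is not stationary, every round gains a state. After
  -- `Fintype.card S` rounds it is stationary or contains everything, and then it is stationary too.
  have key (k : ℕ) : F (F^[k] (B \ A)) = F^[k] (B \ A) ∨ k ≤ (F^[k] (B \ A)).ncard := by
    induction k with
    | zero => exact .inr (Nat.zero_le _)
    | succ k ih =>
      rw [Function.iterate_succ_apply']
      by_cases h : F (F^[k] (B \ A)) = F^[k] (B \ A)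
      · left; rw [h, h]
      · right
        have h₁ : F^[k] (B \ A) ⊂ F (F^[k] (B \ A)) :=
          Set.ssubset_iff_subset_ne.2 ⟨Set.subset_union_left, Ne.symm h⟩
        have h₂ := Set.ncard_lt_ncard h₁ (Set.toFinite _)
        have h₃ := ih.resolve_left h
        omega
  have hfix : F (F^[Fintype.card S] (B \ A)) = F^[Fintype.card S] (B \ A) := by
    refine (key _).elim _root_.id fun h => ?_
    have : F^[Fintype.card S] (B \ A) = Set.univ := by
      refine Set.eq_of_subset_of_ncard_le (Set.subset_univ _) ?_ (Set.toFinite _)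
      rwa [Set.ncard_univ, Nat.card_eq_fintype_card]
    rw [this]
    exact Set.univ_union _
  refine Set.Subset.antisymm ?_ (reach_subset ?_ ?_)
  · have h (k : ℕ) : F^[k] (B \ A) ⊆ Reach R B A := by
      induction k with
      | zero => exact diff_subset_reach
      | succ k ih =>
        rw [Function.iterate_succ_apply']
        refine Set.union_subset ih (subset_trans ?_ (post_reach_diff_subset (R := R)))
        rintro t ⟨⟨s, hs, hst⟩, ht⟩
        exact ⟨⟨s, ih hs, hst⟩, ht⟩
    exact h _
  · have h (k : ℕ) : B \ A ⊆ F^[k] (B \ A) := by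
      induction k with
      | zero => exact subset_rfl
      | succ k ih =>
        rw [Function.iterate_succ_apply']
        exact ih.trans Set.subset_union_left
    exact h _
  · exact (Set.union_eq_left.1 hfix)

/-! ### Sequential composition -/

/-- The walk `f k, …, f n` can be cut for the subgoals `gs`, after a subgoal with target `C`. -/
def Cuts : Set S → List (Set S × Set S) → (ℕ → S) → ℕ → ℕ → Prop
  | _, [], _, _, _ => True
  | C, p :: gs, f, k, n => ∃ i, k ≤ i ∧ i ≤ n ∧ f i ∈ C ∩ p.1 ∧ Cuts p.2 gs f i n

/-- The target of the last subgoal, after a subgoal with target `C`. -/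
def lastTarget : Set S → List (Set S × Set S) → Set S
  | C, [] => C
  | _, p :: gs => lastTarget p.2 gs

/-- An earlier start leaves more room for cuts; this is why the greedy choice is optimal. -/
theorem Cuts.mono {C : Set S} {gs : List (Set S × Set S)} {f : ℕ → S} {k k' n : ℕ}
    (h : Cuts C gs f k n) (hk : k' ≤ k) : Cuts C gs f k' n := by
  cases gs with
  | nil => trivial
  | cons p gs =>
    obtain ⟨i, hi, h⟩ := h
    exact ⟨i, hk.trans hi, h⟩

theorem cuts_shift (C : Set S) (gs : List (Set S × Set S)) (f : ℕ → S) (j k n : ℕ) :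
    Cuts C gs (fun i => f (j + i)) k n ↔ Cuts C gs f (j + k) (j + n) := by
  induction gs generalizing C k with
  | nil => exact Iff.rfl
  | cons p gs ih =>
    constructor
    · rintro ⟨i, h₁, h₂, h₃, h₄⟩
      exact ⟨j + i, by omega, by omega, h₃, (ih _ _).1 h₄⟩
    · rintro ⟨i, h₁, h₂, h₃, h₄⟩
      obtain ⟨i, rfl⟩ := Nat.exists_eq_add_of_le (show j ≤ i by omega)
      exact ⟨i, by omega, by omega, h₃, (ih _ _).2 h₄⟩

theorem Cuts.congr {C : Set S} {gs : List (Set S × Set S)} {f g : ℕ → S} {k n : ℕ}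
    (h : Cuts C gs f k n) (hfg : ∀ i, k ≤ i → i ≤ n → f i = g i) : Cuts C gs g k n := by
  induction gs generalizing C k with
  | nil => trivial
  | cons p gs ih =>
    obtain ⟨i, h₁, h₂, h₃, h₄⟩ := h
    exact ⟨i, h₁, h₂, hfg i h₁ h₂ ▸ h₃, ih h₄ fun i' h₁' h₂' => hfg i' (h₁.trans h₁') h₂'⟩

/-- Some walk from `B` to `T` cannot be cut for the subgoals `gs`. -/
def Uncut (R : S → S → Prop) (T : Set S) (C : Set S) (gs : List (Set S × Set S)) (B : Set S) :
    Prop :=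
  ∃ f n, IsWalk R f n ∧ f 0 ∈ B ∧ f n ∈ T ∧ ¬ Cuts C gs f 0 n

/-- A walk that cannot be cut either never meets `C ∩ p.1`, or its remainder from the first meeting
on cannot be cut for the remaining subgoals. The first meeting is at the start, in `B`, or just
after a walk from `B` that avoids `C ∩ p.1`. Conversely, by `Cuts.mono` a cut at any later meeting
would give one at the first. -/
theorem uncut_cons {T C B : Set S} {p : Set S × Set S} {gs : List (Set S × Set S)} :
    Uncut R T C (p :: gs) B ↔ (Reach R B (C ∩ p.1) ∩ T).Nonempty ∨
      Uncut R T p.2 gs ((C ∩ p.1) ∩ (B ∪ Post R (Reach R B (C ∩ p.1)))) := by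
  classical
  constructor
  · rintro ⟨f, n, hf, h₀, hn, hc⟩
    by_cases h : ∃ i, i ≤ n ∧ f i ∈ C ∩ p.1
    · right
      obtain ⟨hj, hjA⟩ := Nat.find_spec h
      have hmin (i : ℕ) (hi : i < Nat.find h) : f i ∉ C ∩ p.1 := fun hi' =>
        Nat.find_min h hi ⟨by omega, hi'⟩
      generalize Nat.find h = j at *
      refine ⟨fun i => f (j + i), n - j, hf.shift j, ⟨hjA, ?_⟩, ?_, fun h' => hc ?_⟩
      · cases j with
        | zero => exact .inl h₀
        | succ j =>
          exact .inr ⟨f j, ⟨f, j, hf.mono (by omega), h₀, rfl, fun i hi => hmin i (by omega)⟩,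
            hf j hj⟩
      · simpa [hj] using hn
      · refine ⟨j, Nat.zero_le _, hj, hjA, ?_⟩
        simpa [hj] using (cuts_shift _ _ _ _ _ _).1 h'
    · left
      push Not at h
      exact ⟨f n, ⟨f, n, hf, h₀, rfl, h⟩, hn⟩
  · rintro (⟨t, ⟨f, n, hf, h₀, rfl, hA⟩, hn⟩ | ⟨f, n, hf, ⟨h₀, hB | ⟨s, ⟨g, k, hg, hg₀, rfl, hA⟩, hs⟩⟩,
      hn, hc⟩)
    · refine ⟨f, n, hf, h₀, hn, ?_⟩
      rintro ⟨i, -, hi, hi', -⟩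
      exact hA i hi hi'
    · refine ⟨f, n, hf, hB, hn, ?_⟩
      rintro ⟨i, -, -, -, hi⟩
      exact hc (hi.mono (Nat.zero_le _))
    · obtain ⟨w, hw, h₁, h₂⟩ := hg.glue hf hs
      refine ⟨w, _, hw, by rwa [h₁ 0 (Nat.zero_le _)], by rwa [h₂], ?_⟩
      rintro ⟨i, -, hi, hi', h⟩
      -- The prefix avoids `C ∩ p.1`, so the cut lies in the second part of the glued walk.
      have hik : k + 1 ≤ i := by
        by_contra hik
        rw [h₁ i (by omega)] at hi'
        exact hA i (by omega) hi'
      have h := (cuts_shift p.2 gs w (k + 1) 0 n).2 (h.mono hik)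
      simp only [h₂] at h
      exact hc h

/-! ### Parallel composition -/

/-- The walk `f 0, …, f n` is covered by factors for the subgoals `G i`. -/
def Covered {ι : Type} (G : ι → Set S × Set S) (f : ℕ → S) (n : ℕ) : Prop :=
  ∃ k l : ι → ℕ, (∀ i, k i ≤ l i ∧ l i ≤ n ∧ f (k i) ∈ (G i).1 ∧
    f (l i) ∈ (G i).2) ∧ ∀ j < n, ∃ i, k i ≤ j ∧ j + 1 ≤ l i

/-- The intervals of different goals are chosen independently, and a wider interval covers more. If
every goal has some factor, the widest choices are valid and cover every transition that any choice
covers. -/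
theorem not_covered_iff {ι : Type} {G : ι → Set S × Set S} {f : ℕ → S} {n : ℕ} :
    ¬ Covered G f n ↔ (∃ i, ∀ k l, k ≤ l → l ≤ n → f k ∈ (G i).1 → f l ∉ (G i).2) ∨
      ∃ j < n, ∀ i : ι, (∀ k ≤ j, f k ∉ (G i).1) ∨
        ∀ l, j < l → l ≤ n → f l ∉ (G i).2 := by
  classical
  constructor
  · contrapose!
    rintro ⟨h₁, h₂⟩
    have hk (i : ι) : ∃ k, f k ∈ (G i).1 :=
      let ⟨k, _, _, _, h, _⟩ := h₁ i
      ⟨k, h⟩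
    -- From the first source to the last target not after `n`.
    refine ⟨fun i => Nat.find (hk i), fun i => Nat.findGreatest (fun l => f l ∈ (G i).2) n,
      fun i => ?_, fun j hj => ?_⟩
    · obtain ⟨k, l, hkl, hl, h, h'⟩ := h₁ i
      exact ⟨((Nat.find_min' (hk i) h).trans hkl).trans (Nat.le_findGreatest hl h'),
        Nat.findGreatest_le n, Nat.find_spec (hk i),
        Nat.findGreatest_spec (P := fun l => f l ∈ (G i).2) hl h'⟩
    · obtain ⟨i, ⟨k, hkj, h⟩, l, hjl, hl, h'⟩ := h₂ j hj
      exact ⟨i, (Nat.find_min' (hk i) h).trans hkj, Nat.le_trans hjl (Nat.le_findGreatest hl h')⟩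
  · rintro h ⟨k, l, hkl, hc⟩
    rcases h with ⟨i, h⟩ | ⟨j, hj, h⟩
    · exact h (k i) (l i) (hkl i).1 (hkl i).2.1 (hkl i).2.2.1 (hkl i).2.2.2
    · obtain ⟨i, h₁, h₂⟩ := hc j hj
      rcases h i with h | h
      · exact h _ h₁ (hkl i).2.2.1
      · exact h _ h₂ (hkl i).2.1 (hkl i).2.2.2

/-- Some walk from `B` to `T` has a proper prefix that avoids `U`, and the rest avoids `W`. -/
def Splits (R : S → S → Prop) (B T U W : Set S) : Prop :=
  ∃ f n, IsWalk R f n ∧ f 0 ∈ B ∧ f n ∈ T ∧ ∃ j < n, (∀ k ≤ j, f k ∉ U) ∧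
    ∀ l, j < l → l ≤ n → f l ∉ W

theorem splits_iff {B T U W : Set S} :
    Splits R B T U W ↔ (Reach R (Post R (Reach R B U)) W ∩ T).Nonempty := by
  constructor
  · rintro ⟨f, n, hf, h₀, hn, j, hj, hU, hW⟩
    exact ⟨f n, ⟨fun i => f (j + 1 + i), n - (j + 1), hf.shift _,
      ⟨f j, ⟨f, j, hf.mono hj.le, h₀, rfl, hU⟩, hf j hj⟩,
      congrArg f (by omega), fun i hi => hW _ (by omega) (by omega)⟩, hn⟩
  · rintro ⟨t, ⟨g, n, hg, ⟨s, ⟨f, m, hf, h₀, rfl, hU⟩, hs⟩, rfl, hW⟩, hn⟩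
    obtain ⟨w, hw, h₁, h₂⟩ := hf.glue hg hs
    refine ⟨w, _, hw, by rwa [h₁ 0 (Nat.zero_le _)], by rwa [h₂], m, by omega,
      fun k hk => by rw [h₁ k hk]; exact hU k hk, fun l hl hl' => ?_⟩
    obtain ⟨l, rfl⟩ := Nat.exists_eq_add_of_le (show m + 1 ≤ l from hl)
    rw [h₂]
    exact hW l (by omega)

/-- If the source occurs, no target may follow its first occurrence. When that is at position `0`,
the whole walk avoids the target; otherwise the walk splits at the transition leading to it. -/
theorem exists_not_matched_iff {B T : Set S} {p : Set S × Set S} :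
    (∃ f n, IsWalk R f n ∧ f 0 ∈ B ∧ f n ∈ T ∧ ∀ k l, k ≤ l → l ≤ n → f k ∈ p.1 → f l ∉ p.2) ↔
      (Reach R B p.1 ∩ T).Nonempty ∨ (Reach R B p.2 ∩ T).Nonempty ∨ Splits R B T p.1 p.2 := by
  classical
  constructor
  · rintro ⟨f, n, hf, h₀, hn, h⟩
    by_cases hU : ∃ k, k ≤ n ∧ f k ∈ p.1
    · right
      obtain ⟨hj, hjU⟩ := Nat.find_spec hU
      have hmin (i : ℕ) (hi : i < Nat.find hU) : f i ∉ p.1 := fun hi' =>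
        Nat.find_min hU hi ⟨by omega, hi'⟩
      generalize Nat.find hU = j at *
      cases j with
      | zero => exact .inl ⟨f n, ⟨f, n, hf, h₀, rfl, fun l hl => h 0 l (Nat.zero_le _) hl hjU⟩, hn⟩
      | succ j =>
        exact .inr ⟨f, n, hf, h₀, hn, j, hj, fun k hk => hmin k (by omega),
          fun l hl hl' => h (j + 1) l hl hl' hjU⟩
    · push Not at hU
      exact .inl ⟨f n, ⟨f, n, hf, h₀, rfl, hU⟩, hn⟩
  · rintro (⟨t, ⟨f, n, hf, h₀, rfl, hA⟩, hn⟩ | ⟨t, ⟨f, n, hf, h₀, rfl, hA⟩, hn⟩ |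
      ⟨f, n, hf, h₀, hn, j, hj, hU, hW⟩)
    · exact ⟨f, n, hf, h₀, hn, fun k l hkl hl h => absurd h (hA k (hkl.trans hl))⟩
    · exact ⟨f, n, hf, h₀, hn, fun k l hkl hl _ => hA l hl⟩
    · refine ⟨f, n, hf, h₀, hn, fun k l hkl hl h => ?_⟩
      by_cases hk : k ≤ j
      · exact absurd h (hU k hk)
      · exact hW l (by omega) hl

theorem exists_not_covered_iff {B T : Set S} {ι : Type} {G : ι → Set S × Set S} :
    (∃ f n, IsWalk R f n ∧ f 0 ∈ B ∧ f n ∈ T ∧ ¬ Covered G f n) ↔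
      (∃ i, (Reach R B (G i).1 ∩ T).Nonempty ∨ (Reach R B (G i).2 ∩ T).Nonempty ∨
        Splits R B T (G i).1 (G i).2) ∨
      ∃ I : Set (ι), Splits R B T {s | ∃ i ∈ I, s ∈ (G i).1}
        {s | ∃ i ∉ I, s ∈ (G i).2} := by
  simp only [← exists_not_matched_iff, not_covered_iff]
  constructor
  · rintro ⟨f, n, hf, h₀, hn, ⟨p, h⟩ | ⟨j, hj, h⟩⟩
    · exact .inl ⟨p, f, n, hf, h₀, hn, h⟩
    -- The set to be guessed: the goals with no source up to position `j`. All others then have no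
    -- target beyond `j`.
    · refine .inr ⟨{i | ∀ k ≤ j, f k ∉ (G i).1}, f, n, hf, h₀, hn, j, hj, ?_, ?_⟩
      · rintro k hk ⟨i, hi, h'⟩
        exact hi k hk h'
      · rintro l hl hl' ⟨i, hi, h'⟩
        exact ((h i).resolve_left hi) l hl hl' h'
  · rintro (⟨p, f, n, hf, h₀, hn, h⟩ | ⟨I, f, n, hf, h₀, hn, j, hj, hU, hW⟩)
    · exact ⟨f, n, hf, h₀, hn, .inl ⟨p, h⟩⟩
    · refine ⟨f, n, hf, h₀, hn, .inr ⟨j, hj, fun i => ?_⟩⟩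
      by_cases hi : i ∈ I
      · exact .inl fun k hk h => hU k hk ⟨i, hi, h⟩
      · exact .inr fun l hl hl' h => hW l hl hl' ⟨i, hi, h⟩

end Walks

end AttackTree

/-! ### Paths of transition systems as walks -/

namespace AttackTree

section Paths

variable {S AP : Type} {M : TransitionSystem S AP}

/-- The transition relation as a predicate. -/
def TransitionSystem.Step (M : TransitionSystem S AP) (s t : S) : Prop := (s, t) ∈ M.trans

/-- The pair of sets of states of a goal. -/
def TransitionSystem.goalSets (M : TransitionSystem S AP) (g : AP × AP) : Set S × Set S :=
  (M.label g.1, M.label g.2)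

/-- The state of a path at a position; from the end of the path on, this is the last state. -/
def Path.state (π : Path M) (i : ℕ) : S := π.toFun ⟨min i π.length, by omega⟩

theorem Path.state_zero (π : Path M) : Path.state π 0 = π.head :=
  congrArg π.toFun (Fin.ext (Nat.zero_min _))

theorem Path.state_length (π : Path M) : Path.state π π.length = π.last :=
  congrArg π.toFun (Fin.ext (Nat.min_self _))

theorem Path.isWalk (π : Path M) : IsWalk M.Step (Path.state π) π.length := by
  intro i hi
  have h := π.step ⟨i, hi⟩
  have h₁ : Path.state π i = π.toFun (Fin.castSucc ⟨i, hi⟩) :=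
    congrArg π.toFun (Fin.ext (min_eq_left hi.le))
  have h₂ : Path.state π (i + 1) = π.toFun (Fin.succ ⟨i, hi⟩) :=
    congrArg π.toFun (Fin.ext (min_eq_left hi))
  rw [h₁, h₂]
  exact h

theorem IsWalk.exists_path {f : ℕ → S} {n : ℕ} (h : IsWalk M.Step f n) :
    ∃ π : Path M, π.length = n ∧ ∀ i ≤ n, Path.state π i = f i :=
  ⟨⟨n, fun i => f i, fun i => h i i.isLt⟩, rfl, fun _ hi => congrArg f (min_eq_left hi)⟩

theorem mem_goalSem {π : Path M} {g : AP × AP} : π ∈ goalSem M g ↔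
    Path.state π 0 ∈ (M.goalSets g).1 ∧ Path.state π π.length ∈ (M.goalSets g).2 := by
  rw [Path.state_zero, Path.state_length]; rfl

theorem Path.state_factor (π : Path M) {k l : ℕ} (hkl : k ≤ l) (hl : l ≤ π.length) {i : ℕ}
    (hi : i ≤ l - k) : Path.state (π.factor k l hkl hl) i = Path.state π (k + i) :=
  congrArg π.toFun (Fin.ext (show k + min i (l - k) = min (k + i) π.length by omega))

theorem factor_mem_goalSem {π : Path M} {g : AP × AP} {k l : ℕ} (hkl : k ≤ l)
    (hl : l ≤ π.length) : π.factor k l hkl hl ∈ goalSem M g ↔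
      Path.state π k ∈ (M.goalSets g).1 ∧ Path.state π l ∈ (M.goalSets g).2 := by
  rw [mem_goalSem, Path.state_factor π hkl hl (Nat.zero_le _),
    Path.state_factor π hkl hl (show (π.factor k l hkl hl).length ≤ l - k from le_rfl)]
  simp [Path.factor, hkl]

/-- At a cut the target of one goal meets the source of the next, so only the first source and the
last target remain as separate conditions. -/
theorem mem_concatAll {π : Path M} {g : AP × AP} {gs : List (AP × AP)} :
    π ∈ concatAll ((g :: gs).map (goalSem M)) ↔ Path.state π 0 ∈ (M.goalSets g).1 ∧
      Path.state π π.length ∈ lastTarget (M.goalSets g).2 (gs.map M.goalSets) ∧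
      Cuts (M.goalSets g).2 (gs.map M.goalSets) (Path.state π) 0 π.length := by
  induction gs generalizing π g with
  | nil => simp [concatAll, mem_goalSem, lastTarget, Cuts]
  | cons p gs ih =>
    have h : π ∈ concatAll ((g :: p :: gs).map (goalSem M)) ↔ ∃ (i : ℕ) (hi : i ≤ π.length),
        π.factor 0 i (Nat.zero_le i) hi ∈ goalSem M g ∧
        π.factor i π.length hi le_rfl ∈ concatAll ((p :: gs).map (goalSem M)) := Iff.rfl
    have hc (i : ℕ) (hi : i ≤ π.length) : π.factor i π.length hi le_rfl ∈
        concatAll ((p :: gs).map (goalSem M)) ↔ Path.state π i ∈ (M.goalSets p).1 ∧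
        Path.state π π.length ∈ lastTarget (M.goalSets p).2 (gs.map M.goalSets) ∧
        Cuts (M.goalSets p).2 (gs.map M.goalSets) (Path.state π) i π.length := by
      have hl : (π.factor i π.length hi le_rfl).length = π.length - i := rfl
      have hs (j : ℕ) (hj : j ≤ π.length - i) := Path.state_factor π hi le_rfl hj
      have hcuts := cuts_shift (M.goalSets p).2 (gs.map M.goalSets) (Path.state π) i 0
        (π.length - i)
      rw [Nat.add_sub_cancel' hi, Nat.add_zero] at hcuts
      rw [ih, hl, hs _ le_rfl, hs _ (Nat.zero_le _), Nat.add_sub_cancel' hi, Nat.add_zero,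
        ← hcuts]
      refine and_congr_right fun _ => and_congr_right fun _ => ⟨fun h => ?_, fun h => ?_⟩
      · exact h.congr fun j _ hj => hs j hj
      · exact h.congr fun j _ hj => (hs j hj).symm
    rw [h]
    constructor
    · rintro ⟨i, hi, h₁, h₂⟩
      rw [factor_mem_goalSem] at h₁
      rw [hc] at h₂
      exact ⟨h₁.1, h₂.2.1, i, Nat.zero_le i, hi, ⟨h₁.2, h₂.1⟩, h₂.2.2⟩
    · rintro ⟨h₀, hl, i, -, hi, h₁, h₂⟩
      exact ⟨i, hi, (factor_mem_goalSem _ _).2 ⟨h₀, h₁.1⟩, (hc i hi).2 ⟨h₁.2, hl, h₂⟩⟩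

theorem mem_and_iff {π : Path M} {gs : List (AP × AP)} : π ∈ composedSem M .AND gs ↔
    Covered (fun i : Fin gs.length => M.goalSets (gs.get i)) (Path.state π) π.length := by
  constructor
  · rintro ⟨ρ, hρ, k, l, ha, hc⟩
    refine ⟨k, l, fun i => ?_, hc⟩
    obtain ⟨hkl, hl, h⟩ := ha i
    have := hρ i
    rw [← h, factor_mem_goalSem] at this
    exact ⟨hkl, hl, this⟩
  · rintro ⟨k, l, h, hc⟩
    exact ⟨fun i => π.factor (k i) (l i) (h i).1 (h i).2.1,
      fun i => (factor_mem_goalSem _ _).2 (h i).2.2, k, l, fun i => ⟨(h i).1, (h i).2.1, rfl⟩, hc⟩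

theorem Covered.congr {ι : Type} {G : ι → Set S × Set S} {f g : ℕ → S} {n : ℕ}
    (h : Covered G f n) (hfg : ∀ i ≤ n, f i = g i) : Covered G g n := by
  obtain ⟨k, l, h, hc⟩ := h
  refine ⟨k, l, fun i => ?_, hc⟩
  obtain ⟨h₁, h₂, h₃⟩ := h i
  rw [← hfg _ (h₁.trans h₂), ← hfg _ h₂]
  exact ⟨h₁, h₂, h₃⟩

/-- Passes from paths to walks. A walk is a function on all of `ℕ`, so `hQ` demands that `Q` ignore
the values beyond `n`. -/
theorem not_goalSem_subset_iff {g : AP × AP} {A : Set (Path M)} {Q : (ℕ → S) → ℕ → Prop}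
    (hA : ∀ π, π ∈ A ↔ Q (Path.state π) π.length)
    (hQ : ∀ f f' n, (∀ i ≤ n, f i = f' i) → Q f n → Q f' n) :
    ¬ goalSem M g ⊆ A ↔ ∃ f n, IsWalk M.Step f n ∧ f 0 ∈ (M.goalSets g).1 ∧
      f n ∈ (M.goalSets g).2 ∧ ¬ Q f n := by
  rw [Set.not_subset]
  constructor
  · rintro ⟨π, hπ, h⟩
    rw [mem_goalSem] at hπ
    rw [hA] at h
    exact ⟨_, _, Path.isWalk π, hπ.1, hπ.2, h⟩
  · rintro ⟨f, n, hf, h₀, hn, h⟩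
    obtain ⟨π, rfl, hπ⟩ := hf.exists_path
    refine ⟨π, mem_goalSem.2 ?_, fun h' => h (hQ _ _ _ hπ ((hA _).1 h'))⟩
    rw [hπ 0 (Nat.zero_le _), hπ _ le_rfl]
    exact ⟨h₀, hn⟩

theorem goalSem_subset_or_iff {g : AP × AP} {gs : List (AP × AP)} :
    goalSem M g ⊆ composedSem M .OR gs ↔ ¬ ∃ s ∈ (M.goalSets g).1, ∃ t ∈ (M.goalSets g).2,
      t ∈ Reach M.Step {s} ∅ ∧ ¬ ∃ p ∈ gs, s ∈ (M.goalSets p).1 ∧ t ∈ (M.goalSets p).2 := by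
  rw [← not_iff_not, not_not, not_goalSem_subset_iff (A := composedSem M .OR gs)
    (Q := fun f n => ∃ p ∈ gs, f 0 ∈ (M.goalSets p).1 ∧ f n ∈ (M.goalSets p).2)]
  · constructor
    · rintro ⟨f, n, hf, h₀, hn, h⟩
      exact ⟨f 0, h₀, f n, hn, ⟨f, n, hf, rfl, rfl, fun _ _ => not_false⟩, h⟩
    · rintro ⟨s, h₀, t, hn, ⟨f, n, hf, rfl, rfl, -⟩, h⟩
      exact ⟨f, n, hf, h₀, hn, h⟩
  · intro π
    simp only [composedSem, Set.mem_iUnion, mem_goalSem, exists_prop]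
  · intro f f' n h
    rw [h 0 (Nat.zero_le _), h n le_rfl]
    exact _root_.id

theorem goalSem_subset_sand_iff {g p : AP × AP} {gs : List (AP × AP)} :
    goalSem M g ⊆ composedSem M .SAND (p :: gs) ↔
      ¬ ((Uncut M.Step (M.goalSets g).2 (M.goalSets p).2 (gs.map M.goalSets) (M.goalSets g).1 ∨
        (Reach M.Step ((M.goalSets g).1 \ (M.goalSets p).1) ∅ ∩ (M.goalSets g).2).Nonempty) ∨
        (Reach M.Step (M.goalSets g).1 ∅ ∩ ((M.goalSets g).2 \
          lastTarget (M.goalSets p).2 (gs.map M.goalSets))).Nonempty) := by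
  rw [← not_iff_not, not_not, not_goalSem_subset_iff (A := composedSem M .SAND (p :: gs))
    (Q := fun f n => f 0 ∈ (M.goalSets p).1 ∧
      f n ∈ lastTarget (M.goalSets p).2 (gs.map M.goalSets) ∧
      Cuts (M.goalSets p).2 (gs.map M.goalSets) f 0 n)]
  · constructor
    · rintro ⟨f, n, hf, h₀, hn, h⟩
      by_cases h₁ : f 0 ∈ (M.goalSets p).1
      · by_cases h₂ : f n ∈ lastTarget (M.goalSets p).2 (gs.map M.goalSets)
        · exact .inl (.inl ⟨f, n, hf, h₀, hn, fun h₃ => h ⟨h₁, h₂, h₃⟩⟩)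
        · exact .inr ⟨f n, ⟨f, n, hf, h₀, rfl, fun _ _ => not_false⟩, hn, h₂⟩
      · exact .inl (.inr ⟨f n, ⟨f, n, hf, ⟨h₀, h₁⟩, rfl, fun _ _ => not_false⟩, hn⟩)
    · rintro ((⟨f, n, hf, h₀, hn, h⟩ | ⟨t, ⟨f, n, hf, h₀, rfl, -⟩, hn⟩) |
        ⟨t, ⟨f, n, hf, h₀, rfl, -⟩, hn⟩)
      · exact ⟨f, n, hf, h₀, hn, fun h' => h h'.2.2⟩
      · exact ⟨f, n, hf, h₀.1, hn, fun h' => h₀.2 h'.1⟩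
      · exact ⟨f, n, hf, h₀, hn.1, fun h' => hn.2 h'.2.1⟩
  · exact fun π => mem_concatAll
  · intro f f' n h
    rw [h 0 (Nat.zero_le _), h n le_rfl]
    exact fun h' => ⟨h'.1, h'.2.1, h'.2.2.congr fun i _ hi => h i hi⟩

theorem not_goalSem_subset_and_iff {g : AP × AP} {gs : List (AP × AP)} :
    ¬ goalSem M g ⊆ composedSem M .AND gs ↔ ∃ f n, IsWalk M.Step f n ∧ f 0 ∈ (M.goalSets g).1 ∧
      f n ∈ (M.goalSets g).2 ∧ ¬ Covered (fun i : Fin gs.length => M.goalSets (gs.get i)) f n :=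
  not_goalSem_subset_iff (fun _ => mem_and_iff) fun _ _ _ h h' => h'.congr h

end Paths

/-! ### Correctness of the decision procedures -/

section Bits

variable {m : ℕ}

/-- The set of states of a bit vector. -/
def vset (m : ℕ) (v : List Bool) : Set (Fin m) := {s | bit v s = true}

/-- The relation of an adjacency matrix. -/
def adjRel (m : ℕ) (E : List (List Bool)) (s t : Fin m) : Prop := bit (E.getD s []) t = true

theorem bit_vec {f : ℕ → Bool} (s : Fin m) : bit (vec m f) s = f s := by
  simp [bit, vec, List.getD_eq_getElem?_getD]

theorem vset_vec (f : ℕ → Bool) : vset m (vec m f) = {s : Fin m | f s = true} := by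
  ext s; simp [vset, bit_vec]

theorem vset_nil : vset m [] = ∅ := by
  ext s; simp [vset, bit]

theorem vset_bitVector (A : Set (Fin m)) : vset m (bitVector A) = A := by
  ext s; simp [vset, bit, bitVector, List.getD_eq_getElem?_getD]

theorem any_range_iff {p : ℕ → Bool} :
    (List.range m).any p = true ↔ ∃ s : Fin m, p s = true := by
  simp [List.any_eq_true, Fin.exists_iff]

theorem vset_post (E : List (List Bool)) (v : List Bool) :
    vset m (post m E v) = Post (adjRel m E) (vset m v) := by
  ext t
  rw [post, vset_vec, Set.mem_ofPred_eq, any_range_iff]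
  simp [Post, vset, adjRel]

theorem vset_reach (E : List (List Bool)) (v A : List Bool) :
    vset m (reach m E v A) = Reach (adjRel m E) (vset m v) (vset m A) := by
  rw [← iterate_eq_reach, Fintype.card_fin, reach]
  have h (k : ℕ) : vset m ((fun X => vec m fun t => bit X t || (bit (post m E X) t && !bit A t))^[k]
      (vec m fun t => bit v t && !bit A t)) =
      (fun X => X ∪ (Post (adjRel m E) X \ vset m A))^[k] (vset m v \ vset m A) := by
    induction k with
    | zero =>
      rw [Function.iterate_zero_apply, Function.iterate_zero_apply, vset_vec]
      ext s
      simp [vset]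
    | succ k ih =>
      rw [Function.iterate_succ_apply', Function.iterate_succ_apply', ← ih, ← vset_post, vset_vec]
      ext s
      simp [vset]
  exact h m

theorem meets_iff {v w : List Bool} : meets m v w = true ↔ (vset m v ∩ vset m w).Nonempty := by
  rw [meets, any_range_iff]
  simp [Set.Nonempty, vset]

theorem vset_single (s : Fin m) : vset m (single s) = {s} := by
  have h (k t : ℕ) : bit (single k) t = true ↔ t = k := by
    induction k generalizing t with
    | zero => cases t <;> simp [single, bit]
    | succ k ih =>
      rw [single, Function.iterate_succ_apply']
      cases t with
      | zero => simp [bit]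
      | succ t => simpa [bit, single] using ih t
  ext t
  simp [vset, h, Fin.ext_iff]

/-! ### Correctness of the procedures for the three operators -/

namespace Data

variable {d : Data}

/-- The sets of states of a subgoal. -/
def goalSets (m : ℕ) (p : List Bool × List Bool) : Set (Fin m) × Set (Fin m) :=
  (vset m p.1, vset m p.2)

/-- The transition relation. -/
def rel (d : Data) : Fin d.num → Fin d.num → Prop := adjRel d.num d.adj

theorem vset_reach (v A : List Bool) :
    vset d.num (d.reach v A) = Reach d.rel (vset d.num v) (vset d.num A) :=
  AttackTree.vset_reach _ _ _

theorem matchOr_iff : d.matchOr = true ↔ ¬ ∃ s ∈ vset d.num d.src, ∃ t ∈ vset d.num d.tgt,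
    t ∈ Reach d.rel {s} ∅ ∧ ¬ ∃ p ∈ d.goals, s ∈ (goalSets d.num p).1 ∧
      t ∈ (goalSets d.num p).2 := by
  have h (s t : Fin d.num) : t ∈ Reach d.rel {s} ∅ ↔ bit (d.reach (single s) []) t = true := by
    rw [← vset_single s, ← vset_nil, ← vset_reach]; rfl
  simp only [h]
  rw [matchOr, Bool.not_eq_true', ← Bool.not_eq_true, any_range_iff]
  simp only [Bool.and_eq_true, any_range_iff]
  simp [goalSets, vset, and_assoc]

/-- The invariant of the fold, one use of `uncut_cons` per step: the flag records its first
alternative, and the set of states becomes the new set of starting points in its second. -/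
theorem sandFold_iff (gs : List (List Bool × List Bool)) (st : List Bool × List Bool × Bool) :
    ((gs.foldl d.sandStep st).2.2 = true ↔ st.2.2 = true ∨ Uncut d.rel (vset d.num d.tgt)
        (vset d.num st.1) (gs.map (goalSets d.num)) (vset d.num st.2.1)) ∧
      vset d.num (gs.foldl d.sandStep st).1 =
        lastTarget (vset d.num st.1) (gs.map (goalSets d.num)) := by
  induction gs generalizing st with
  | nil => simp [lastTarget, Uncut, Cuts]
  | cons p gs ih =>
    have hA : vset d.num (vec d.num fun t => bit st.1 t && bit p.1 t) =
        vset d.num st.1 ∩ vset d.num p.1 := by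
      rw [vset_vec]; ext s; simp [vset]
    have hB : vset d.num (d.sandStep st p).2.1 = (vset d.num st.1 ∩ vset d.num p.1) ∩
        (vset d.num st.2.1 ∪ Post d.rel (Reach d.rel (vset d.num st.2.1)
          (vset d.num st.1 ∩ vset d.num p.1))) := by
      rw [← hA, ← vset_reach, rel, ← vset_post, sandStep, vset_vec, vset_vec]
      ext s; simp [vset]
    rw [List.foldl_cons, List.map_cons, uncut_cons]
    refine ⟨(ih _).1.trans ?_, (ih _).2⟩
    rw [hB, sandStep, Bool.or_eq_true, meets_iff, vset_reach, hA, or_assoc]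
    rfl

theorem matchSand_iff {p : List Bool × List Bool} {gs : List (List Bool × List Bool)}
    (h : d.goals = p :: gs) : d.matchSand = true ↔
      ¬ ((Uncut d.rel (vset d.num d.tgt) (vset d.num p.2) (gs.map (goalSets d.num))
        (vset d.num d.src) ∨
        (Reach d.rel (vset d.num d.src \ vset d.num p.1) ∅ ∩ vset d.num d.tgt).Nonempty) ∨
        (Reach d.rel (vset d.num d.src) ∅ ∩ (vset d.num d.tgt \
          lastTarget (vset d.num p.2) (gs.map (goalSets d.num)))).Nonempty) := by
  obtain ⟨h₁, h₂⟩ := sandFold_iff (d := d) gs (p.2, d.src, false)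
  have h₃ (v w : List Bool) : vset d.num (vec d.num fun t => bit v t && !bit w t) =
      vset d.num v \ vset d.num w := by
    rw [vset_vec]; ext s; simp [vset]
  rw [matchSand, h, Bool.not_eq_true', ← Bool.not_eq_true, Bool.or_eq_true, Bool.or_eq_true,
    meets_iff, meets_iff, vset_reach, vset_reach, h₃, h₃, vset_nil]
  simp only [List.tail_cons, List.headD_cons]
  rw [h₁, h₂]
  simp

theorem split_iff {U W : List Bool} : d.split U W = true ↔
    Splits d.rel (vset d.num d.src) (vset d.num d.tgt) (vset d.num U) (vset d.num W) := by
  rw [split, meets_iff, vset_reach, vset_post, vset_reach, splits_iff]; rfl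

/-- The certificate is read as a set of indices of subgoals. Missing bits count as `false` and
surplus ones are ignored, so every word denotes such a set. -/
theorem mismatchAnd_iff {w : List Bool} : d.mismatchAnd w = true ↔
    (∃ i : Fin d.goals.length,
      (Reach d.rel (vset d.num d.src) (goalSets d.num (d.goals.get i)).1 ∩
        vset d.num d.tgt).Nonempty ∨
      (Reach d.rel (vset d.num d.src) (goalSets d.num (d.goals.get i)).2 ∩
        vset d.num d.tgt).Nonempty ∨
      Splits d.rel (vset d.num d.src) (vset d.num d.tgt) (goalSets d.num (d.goals.get i)).1
        (goalSets d.num (d.goals.get i)).2) ∨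
    Splits d.rel (vset d.num d.src) (vset d.num d.tgt)
      {s | ∃ i ∈ vset d.goals.length w, s ∈ (goalSets d.num (d.goals.get i)).1}
      {s | ∃ i ∉ vset d.goals.length w, s ∈ (goalSets d.num (d.goals.get i)).2} := by
  rw [mismatchAnd, Bool.or_eq_true, List.any_eq_true, List.exists_mem_iff_get, split_iff,
    vset_vec, vset_vec]
  simp only [Bool.or_eq_true, meets_iff, vset_reach, split_iff, or_assoc, any_range_iff]
  simp [vset, goalSets]

end Data

end Bits

end AttackTree

/-! ### Reading the input -/

namespace AttackTree

/-- The code of a symbol of an input word. -/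
def symbol : Option Bool → Bool × Bool × Bool
  | none => (false, true, false)
  | some x => (false, false, x)

/-- The code of a symbol of an input word with a certificate. -/
def symbolWithCertificate : Option Bool ⊕ Bool → Bool × Bool × Bool
  | .inl y => symbol y
  | .inr x => (true, false, x)

/-- Read from the right, the end marker comes before its block: it opens an empty block, to whose
front the bits are then added. -/
theorem foldl_readStep_block (b : List Bool) (st : List (List Bool) × List Bool) :
    (((b.map some ++ [none]).map symbol).reverse).foldl readStep st = (b :: st.1, st.2) := by
  have h (b b' : List Bool) (bs : List (List Bool)) (w : List Bool) :
      ((b.map fun x => symbol (some x)).reverse).foldl readStep (b' :: bs, w) =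
        ((b ++ b') :: bs, w) := by
    induction b with
    | nil => rfl
    | cons x b ih =>
      rw [List.map_cons, List.reverse_cons, List.foldl_append, ih]
      rfl
  have h' : readStep st (symbol none) = ([] :: st.1, st.2) := rfl
  simpa [h', Function.comp_def] using h b [] st.1 st.2

theorem foldl_readStep_blocks (bs : List (List Bool)) (st : List (List Bool) × List Bool) :
    (((bs.flatMap fun b => b.map some ++ [none]).map symbol).reverse).foldl readStep st =
      (bs ++ st.1, st.2) := by
  induction bs with
  | nil => rfl
  | cons b bs ih =>
    rw [List.flatMap_cons, List.map_append, List.reverse_append, List.foldl_append, ih,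
      foldl_readStep_block]
    rfl

theorem foldl_readStep_certificate (w : List Bool) (st : List (List Bool) × List Bool) :
    ((w.map fun x => symbolWithCertificate (.inr x)).reverse).foldl readStep st =
      (st.1, w ++ st.2) := by
  induction w with
  | nil => rfl
  | cons x w ih =>
    rw [List.map_cons, List.reverse_cons, List.foldl_append, ih]
    rfl

theorem readWord_encodeInput (x : Input) :
    readWord ((encodeInput x).reverse.map symbol) = (inputBlocks x, []) := by
  rw [readWord, List.map_reverse, encodeInput, foldl_readStep_blocks, List.append_nil]

theorem readWord_encodeWithCertificate (x : Input) (w : List Bool) :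
    readWord ((encodeWithCertificate encodeInput (x, w)).reverse.map symbolWithCertificate) =
      (inputBlocks x, w) := by
  rw [readWord, List.map_reverse, encodeWithCertificate, List.map_append, List.reverse_append,
    List.foldl_append, List.map_map, List.map_map]
  have h := foldl_readStep_certificate w ([], [])
  have h' := foldl_readStep_blocks (inputBlocks x) ([], w)
  simp only [Function.comp_def, symbolWithCertificate, List.append_nil] at h h' ⊢
  rw [h, encodeInput]
  exact h'

theorem foldl_pairStep {p : ℕ} (gs : List (Fin p × Fin p))
    (l : List (List Bool × List Bool)) :
    (gs.flatMap goalBlocks).foldl pairStep ([], l) =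
      ([], (gs.map fun g => (unary g.1, unary g.2)).reverse ++ l) := by
  induction gs generalizing l with
  | nil => rfl
  | cons g gs ih =>
    have h : [unary g.1, unary g.2].foldl pairStep ([], l) = ([], (unary g.1, unary g.2) :: l) :=
      rfl
    rw [List.flatMap_cons, List.foldl_append, goalBlocks, h, ih]
    simp

/-- The data of an input. -/
def inputData (x : Input) : Data :=
  (x.numStates, List.ofFn fun s => bitVector {t | (s, t) ∈ x.system.trans},
    bitVector (x.system.label x.goal.1), bitVector (x.system.label x.goal.2),
    x.subgoals.map fun g => (bitVector (x.system.label g.1), bitVector (x.system.label g.2)))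

theorem blockData_inputBlocks (x : Input) : blockData (inputBlocks x) = inputData x := by
  -- Rows and labels become opaque lists of known length, so that the positions of the blocks reduce
  -- to arithmetic. The summand `2` in them stands for the two leading unary blocks.
  obtain ⟨rows, hrows⟩ : ∃ l, l = List.ofFn fun s => bitVector {t | (s, t) ∈ x.system.trans} :=
    ⟨_, rfl⟩
  obtain ⟨labels, hlabels⟩ : ∃ l, l = List.ofFn fun a => bitVector (x.system.label a) := ⟨_, rfl⟩
  have hr : rows.length = x.numStates := by simp [hrows]
  have hl : labels.length = x.numProps := by simp [hlabels]
  have hb : inputBlocks x = unary x.numStates :: unary x.numProps :: (rows ++ (labels ++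
      (unary x.goal.1 :: unary x.goal.2 :: x.subgoals.flatMap goalBlocks))) := by
    simp [inputBlocks, hrows, hlabels, goalBlocks]
  have hu (k : ℕ) : (unary k).length = k := List.length_replicate
  have h₀ : ((inputBlocks x).getD 0 []).length = x.numStates := by rw [hb]; simp [hu]
  have h₁ : ((inputBlocks x).getD 1 []).length = x.numProps := by rw [hb]; simp [hu]
  have hL (a : Fin x.numProps) : blockLabel (inputBlocks x) a = bitVector (x.system.label a) := by
    rw [blockLabel, h₀, hb, show (a : ℕ) + (x.numStates + 2) = rows.length + a + 1 + 1 by omega,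
      List.getD_cons_succ, List.getD_cons_succ, List.getD_append_right _ _ _ _ (by omega),
      Nat.add_sub_cancel_left, List.getD_append _ _ _ _ (by omega), hlabels]
    simp [List.getD_eq_getElem?_getD]
  have hG (k : ℕ) : (inputBlocks x).drop (blockGoal (inputBlocks x) + k) =
      (unary x.goal.1 :: unary x.goal.2 :: x.subgoals.flatMap goalBlocks).drop k := by
    rw [blockGoal, h₀, h₁, hb,
      show x.numProps + (x.numStates + 2) + k = rows.length + (labels.length + k) + 1 + 1 by omega,
      List.drop_succ_cons, List.drop_succ_cons, List.drop_length_add_append,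
      List.drop_length_add_append]
  have hG' (k : ℕ) : (inputBlocks x).getD (blockGoal (inputBlocks x) + k) [] =
      (unary x.goal.1 :: unary x.goal.2 :: x.subgoals.flatMap goalBlocks).getD k [] := by
    have := congrArg List.head? (hG k)
    rw [List.head?_drop, List.head?_drop] at this
    rw [List.getD_eq_getElem?_getD, List.getD_eq_getElem?_getD, this]
  have e₁ : (List.range x.numStates).map (fun s => (inputBlocks x).getD (s + 2) []) = rows := by
    apply List.ext_getElem
    · simp [hr]
    · intro s h h'
      rw [List.getElem_map, List.getElem_range, hb, List.getD_cons_succ, List.getD_cons_succ,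
        List.getD_append _ _ _ _ h']
      simp [List.getD_eq_getElem?_getD, h']
  have e₂ := hG' 0
  have e₃ := hG' 1
  simp only [Nat.add_zero, List.getD_cons_zero, List.getD_cons_succ] at e₂ e₃
  rw [blockData, h₀, e₁, e₂, e₃, hG, List.drop_succ_cons, List.drop_succ_cons, List.drop_zero,
    foldl_pairStep, inputData, hu, hu, hL, hL, hrows]
  simp [hL, hu, Function.comp_def]

/-! ### The decision problem -/

theorem adjRel_ofFn (x : Input) : adjRel x.numStates (List.ofFn fun s =>
    bitVector {t | (s, t) ∈ x.system.trans}) = x.system.Step := by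
  funext s t
  have h : (List.ofFn fun s => bitVector {t | (s, t) ∈ x.system.trans}).getD s [] =
      bitVector {t | (s, t) ∈ x.system.trans} := by
    rw [List.getD_eq_getElem?_getD, List.getElem?_ofFn]
    simp [s.isLt]
  have h' := Set.ext_iff.1 (vset_bitVector {t | (s, t) ∈ x.system.trans}) t
  exact propext (by rw [← h] at h'; exact h')

theorem rel_inputData (x : Input) : (inputData x).rel = x.system.Step := adjRel_ofFn x

theorem goalSets_inputData (x : Input) (g : Fin x.numProps × Fin x.numProps) :
    Data.goalSets x.numStates (bitVector (x.system.label g.1), bitVector (x.system.label g.2)) =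
      x.system.goalSets g := by
  rw [Data.goalSets, vset_bitVector, vset_bitVector]; rfl

theorem overMatch_or_iff (x : Input) : OverMatch .OR x ↔ (inputData x).matchOr = true := by
  rw [Data.matchOr_iff, rel_inputData]
  refine goalSem_subset_or_iff.trans (not_congr ?_)
  have h₁ : vset (inputData x).num (inputData x).src = (x.system.goalSets x.goal).1 :=
    vset_bitVector _
  have h₂ : vset (inputData x).num (inputData x).tgt = (x.system.goalSets x.goal).2 :=
    vset_bitVector _
  have h₃ (s t : Fin x.numStates) : (∃ p ∈ (inputData x).goals,
      s ∈ (Data.goalSets x.numStates p).1 ∧ t ∈ (Data.goalSets x.numStates p).2) ↔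
      ∃ p ∈ x.subgoals, s ∈ (x.system.goalSets p).1 ∧ t ∈ (x.system.goalSets p).2 := by
    constructor
    · rintro ⟨p, hp, h⟩
      obtain ⟨g, hg, rfl⟩ := List.mem_map.1 hp
      rw [goalSets_inputData] at h
      exact ⟨g, hg, h⟩
    · rintro ⟨g, hg, h⟩
      refine ⟨_, List.mem_map_of_mem hg, ?_⟩
      rwa [goalSets_inputData]
  rw [h₁, h₂]
  exact exists_congr fun s => and_congr_right fun _ => exists_congr fun t =>
    and_congr_right fun _ => and_congr_right fun _ => not_congr (h₃ s t).symm

theorem overMatch_sand_iff (x : Input) : OverMatch .SAND x ↔ (inputData x).matchSand = true := by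
  obtain ⟨p, gs, h⟩ := List.exists_cons_of_ne_nil x.subgoals_ne_nil
  have h' : (inputData x).goals =
      (bitVector (x.system.label p.1), bitVector (x.system.label p.2)) ::
        gs.map fun g => (bitVector (x.system.label g.1), bitVector (x.system.label g.2)) := by
    simp [inputData, Data.goals, h]
  have h₁ : vset (inputData x).num (inputData x).src = (x.system.goalSets x.goal).1 :=
    vset_bitVector _
  have h₂ : vset (inputData x).num (inputData x).tgt = (x.system.goalSets x.goal).2 :=
    vset_bitVector _
  have h₃ : vset (inputData x).num (bitVector (x.system.label p.1)) = (x.system.goalSets p).1 :=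
    vset_bitVector _
  have h₄ : vset (inputData x).num (bitVector (x.system.label p.2)) = (x.system.goalSets p).2 :=
    vset_bitVector _
  have h₅ : (gs.map fun g => (bitVector (x.system.label g.1), bitVector (x.system.label g.2))).map
      (Data.goalSets (inputData x).num) = gs.map x.system.goalSets := by
    rw [List.map_map]
    exact List.map_congr_left fun g _ => goalSets_inputData x g
  rw [Data.matchSand_iff h', rel_inputData, h₁, h₂, h₃, h₄, h₅, OverMatch, h]
  exact goalSem_subset_sand_iff

/-- Allows the indices of the goals of an input to be replaced by those of its decoded data, where
the list has the same length but is another list. -/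
theorem covered_comp_equiv {S ι ι' : Type} (e : ι ≃ ι') {G : ι' → Set S × Set S} {f : ℕ → S}
    {n : ℕ} : Covered (fun i => G (e i)) f n ↔ Covered G f n := by
  constructor
  · rintro ⟨k, l, h, hc⟩
    refine ⟨fun i => k (e.symm i), fun i => l (e.symm i), fun i => by simpa using h (e.symm i),
      fun j hj => ?_⟩
    obtain ⟨i, hi⟩ := hc j hj
    exact ⟨e i, by simpa using hi⟩
  · rintro ⟨k, l, h, hc⟩
    refine ⟨fun i => k (e i), fun i => l (e i), fun i => h (e i), fun j hj => ?_⟩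
    obtain ⟨i, hi⟩ := hc j hj
    exact ⟨e.symm i, by simpa using hi⟩

theorem not_overMatch_and_iff (x : Input) {N : ℕ} (hN : x.subgoals.length ≤ N) :
    ¬ OverMatch .AND x ↔ ∃ w : List Bool, w.length ≤ N ∧ (inputData x).mismatchAnd w = true := by
  have hlen : x.subgoals.length = (inputData x).goals.length := by simp [inputData, Data.goals]
  have h₁ : vset (inputData x).num (inputData x).src = (x.system.goalSets x.goal).1 :=
    vset_bitVector _
  have h₂ : vset (inputData x).num (inputData x).tgt = (x.system.goalSets x.goal).2 :=
    vset_bitVector _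
  have hc (f : ℕ → Fin x.numStates) (n : ℕ) :
      Covered (fun i : Fin x.subgoals.length => x.system.goalSets (x.subgoals.get i)) f n ↔
      Covered (fun i : Fin (inputData x).goals.length =>
        Data.goalSets x.numStates ((inputData x).goals.get i)) f n := by
    rw [← covered_comp_equiv (finCongr hlen)]
    simp [inputData, Data.goals, goalSets_inputData]
    rfl
  rw [OverMatch, not_goalSem_subset_and_iff]
  simp only [hc]
  rw [exists_not_covered_iff]
  simp only [Data.mismatchAnd_iff, rel_inputData, h₁, h₂]
  constructor
  · rintro (h | ⟨I, h⟩)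
    -- A goal without any factor is found by reachability alone, so any certificate will do.
    · exact ⟨[], Nat.zero_le _, .inl h⟩
    · refine ⟨bitVector I, by simpa [bitVector, ← hlen] using hN, .inr ?_⟩
      rw [vset_bitVector]
      exact h
  · rintro ⟨w, -, h | h⟩
    · exact .inl h
    · exact .inr ⟨_, h⟩

/-- Each subgoal contributes blocks, and each block at least its end marker; so certificates with
one bit per subgoal are no longer than the input. -/
theorem length_subgoals_le (x : Input) : x.subgoals.length ≤ (encodeInput x).length := by
  have h (bs : List (List Bool)) :
      bs.length ≤ (bs.flatMap fun b => b.map some ++ [none]).length := by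
    induction bs with
    | nil => simp
    | cons b bs ih => simp at ih ⊢; omega
  refine le_trans ?_ (h (inputBlocks x))
  have h' (gs : List (Fin x.numProps × Fin x.numProps)) :
      gs.length ≤ (gs.flatMap goalBlocks).length := by
    induction gs with
    | nil => simp
    | cons g gs ih => simp [goalBlocks] at ih ⊢; omega
  have := h' x.subgoals
  rw [inputBlocks, List.length_append]
  omega

theorem inPTIME_or : InPTIME encodeInput (OverMatch .OR) :=
  PolyTime.inPTIME (Data.polyTime_matchOr.comp (polyTime_blockData.comp
    (PolyTime.fst.comp polyTime_readWord))) symbol fun x => by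
    rw [overMatch_or_iff, readWord_encodeInput, blockData_inputBlocks]

theorem inPTIME_sand : InPTIME encodeInput (OverMatch .SAND) :=
  PolyTime.inPTIME (Data.polyTime_matchSand.comp (polyTime_blockData.comp
    (PolyTime.fst.comp polyTime_readWord))) symbol fun x => by
    rw [overMatch_sand_iff, readWord_encodeInput, blockData_inputBlocks]

theorem inCoNP_and : InCoNP encodeInput (OverMatch .AND) := by
  refine ⟨fun y => (inputData y.1).mismatchAnd y.2 = true, .X,
    PolyTime.inPTIME (Data.polyTime_mismatchAnd.comp ((polyTime_blockData.comp
      (PolyTime.fst.comp polyTime_readWord)).pair (PolyTime.snd.comp polyTime_readWord)))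
      symbolWithCertificate fun y => ?_, fun x => ?_⟩
  · rw [readWord_encodeWithCertificate y.1 y.2, blockData_inputBlocks]
  · rw [Polynomial.eval_X]
    exact not_overMatch_and_iff x (length_subgoals_le x)

end AttackTree

end

theorem proposition7 :
    InPTIME AttackTree.encodeInput (AttackTree.OverMatch AttackTree.Op.OR) ∧
      InPTIME AttackTree.encodeInput (AttackTree.OverMatch AttackTree.Op.SAND) ∧
      InCoNP AttackTree.encodeInput (AttackTree.OverMatch AttackTree.Op.AND) := by
  exact ⟨AttackTree.inPTIME_or, AttackTree.inPTIME_sand, AttackTree.inCoNP_and⟩
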